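/- Let $n\ge 2$ be a fixed integer. For $q\ge 1$ let $$A_q=\{(x_1,\dots,x_n)\in(\mathbb{Z}/q\mathbb{Z})^n:\gcd(q,x_1,\dots,x_n)=1\}$$ (column vectors) and let $P_q=A_q/(\mathbb{Z}/q\mathbb{Z})^\times$ be its quotient by scalar multiplication by units. The group $\mathrm{SL}_n(\mathbb{Z})$ acts on $A_q$ and on $P_q$ by reducing matrices modulo $q$ and multiplying. For $X=A_q$ or $X=P_q$ and $x,y\in X$ put $$d(x,y)=\min\{\log\|\gamma\|:\gamma\in\mathrm{SL}_n(\mathbb{Z}),\ \gamma\cdot x=y\},$$ where $\|\cdot\|$ is the operator norm with respect to the Euclidean norm on $\mathbb{R}^n$. Define $$\overline{\alpha}(A_q)=\limsup_{q\to\infty}\max_{x,y\in A_q}\frac{d(x,y)}{\log q},\qquad \underline{\alpha}(A_q)=\liminf_{q\to\infty}\max_{x,y\in A_q}\frac{d(x,y)}{\log q},$$ and define $\overline{\alpha}(P_q)$, $\underline{\alpha}(P_q)$ in the same way with $P_q$ in place of $A_q$; here $q$ runs over all positive integers. Then $$1\le\underline{\alpha}(A_q)\le 1+\frac1n,$$ $$1\le\overline{\alpha}(A_q)\le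 1+\frac1{n-1},$$ $$\frac{n-1}{n}\le\underline{\alpha}(P_q)\le\overline{\alpha}(P_q)=1.$$ -/

import Mathlib

open scoped MatrixGroups

/-- The primitive vectors modulo `q`: `(x₁, …, xₙ) ∈ (ℤ/qℤ)ⁿ` with `gcd(q, x₁, …, xₙ) = 1`, where
every `xᵢ` is represented by the integer `(x i).val`. -/
def PrimVec (n q : ℕ) : Type :=
  {x : Fin n → ZMod q // Nat.gcd q (Finset.univ.gcd fun i => (x i).val) = 1}

/-- Primitive vectors are the vectors whose coordinates generate the unit ideal. -/
theorem primVec_iff {n q : ℕ} (x : Fin n → ZMod q) :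
    Nat.gcd q (Finset.univ.gcd fun i => (x i).val) = 1 ↔ ∃ c : Fin n → ZMod q, c ⬝ᵥ x = 1 := by
  have hval : ∀ a : ZMod q, ((a.val : ℕ) : ZMod q) = a ∨ ((a.val : ℕ) : ZMod q) = -a := by
    intro a
    cases q with
    | zero =>
      have h : ((Int.natAbs a : ℕ) : ℤ) = a ∨ ((Int.natAbs a : ℕ) : ℤ) = -a := by omega
      exact h
    | succ k => exact Or.inl (ZMod.natCast_zmod_val a)
  have hmem : (∃ c : Fin n → ZMod q, c ⬝ᵥ x = 1) ↔ (1 : ZMod q) ∈ Ideal.span (Set.range x) := by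
    rw [Ideal.mem_span_range_iff_exists_fun]
    rfl
  constructor
  · intro h
    rw [hmem]
    have hgcd : ∀ a b : ℕ, (a : ZMod q) ∈ Ideal.span (Set.range x) →
        (b : ZMod q) ∈ Ideal.span (Set.range x) →
        ((Nat.gcd a b : ℕ) : ZMod q) ∈ Ideal.span (Set.range x) := by
      intro a b ha hb
      have e : ((Nat.gcd a b : ℕ) : ZMod q) =
          (a : ZMod q) * (Nat.gcdA a b : ZMod q) + (b : ZMod q) * (Nat.gcdB a b : ZMod q) := by
        have := congrArg (Int.cast : ℤ → ZMod q) (Nat.gcd_eq_gcd_ab a b)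
        push_cast at this
        exact this
      rw [e]
      exact add_mem (Ideal.mul_mem_right _ _ ha) (Ideal.mul_mem_right _ _ hb)
    have hall : ∀ s : Finset (Fin n),
        ((s.gcd fun i => (x i).val : ℕ) : ZMod q) ∈ Ideal.span (Set.range x) := by
      intro s
      induction s using Finset.induction_on with
      | empty => simp
      | insert i s hi ih =>
        rw [Finset.gcd_insert]
        refine hgcd _ _ ?_ ih
        have hx : x i ∈ Ideal.span (Set.range x) := Ideal.subset_span ⟨i, rfl⟩
        rcases hval (x i) with e | e
        · rw [e]; exact hx
        · rw [e]; exact neg_mem hx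
    have := hgcd q _ (by simp) (hall Finset.univ)
    rw [h] at this
    simpa using this
  · rintro ⟨c, hc⟩
    set g := Nat.gcd q (Finset.univ.gcd fun i => (x i).val) with hg
    have hgq : g ∣ q := Nat.gcd_dvd_left _ _
    have hx : ∀ i, ZMod.castHom hgq (ZMod g) (x i) = 0 := by
      intro i
      have hi : g ∣ (x i).val :=
        (Nat.gcd_dvd_right _ _).trans (Finset.gcd_dvd (Finset.mem_univ i))
      have h0 : ZMod.castHom hgq (ZMod g) (((x i).val : ℕ) : ZMod q) = 0 := by
        rw [map_natCast]
        exact (ZMod.natCast_eq_zero_iff _ _).2 hi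
      rcases hval (x i) with e | e
      · rwa [e] at h0
      · rw [e, map_neg, neg_eq_zero] at h0
        exact h0
    have h1 := congrArg (ZMod.castHom hgq (ZMod g)) hc
    simp only [dotProduct, map_sum, map_mul, hx, mul_zero, Finset.sum_const_zero, map_one] at h1
    have h2 : ((1 : ℕ) : ZMod g) = 0 := by rw [Nat.cast_one]; exact h1.symm
    exact Nat.dvd_one.1 ((ZMod.natCast_eq_zero_iff _ _).1 h2)

namespace PrimVec

theorem isPrim_mulVec {n q : ℕ} (g : SL(n, ZMod q)) (x : PrimVec n q) :
    Nat.gcd q (Finset.univ.gcd fun i => ((g.1.mulVec x.1) i).val) = 1 := by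
  obtain ⟨c, hc⟩ := (primVec_iff x.1).1 x.2
  refine (primVec_iff _).2 ⟨Matrix.vecMul c (g⁻¹).1, ?_⟩
  rw [← Matrix.dotProduct_mulVec, Matrix.mulVec_mulVec, ← Matrix.SpecialLinearGroup.coe_mul,
    inv_mul_cancel, Matrix.SpecialLinearGroup.coe_one, Matrix.one_mulVec, hc]

theorem isPrim_units_smul {n q : ℕ} (u : (ZMod q)ˣ) (x : PrimVec n q) :
    Nat.gcd q (Finset.univ.gcd fun i => (((u : ZMod q) • x.1) i).val) = 1 := by
  obtain ⟨c, hc⟩ := (primVec_iff x.1).1 x.2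
  refine (primVec_iff _).2 ⟨((u⁻¹ : (ZMod q)ˣ) : ZMod q) • c, ?_⟩
  rw [smul_dotProduct, dotProduct_smul, hc, smul_eq_mul, smul_eq_mul, mul_one, Units.inv_mul]

/-- `SLₙ(ℤ)` acts on primitive vectors modulo `q`, seen as column vectors: reduce the matrix
modulo `q` and multiply. -/
instance instMulActionSL (n q : ℕ) : MulAction SL(n, ℤ) (PrimVec n q) where
  smul γ x := ⟨(Matrix.SpecialLinearGroup.map (Int.castRingHom (ZMod q)) γ).1.mulVec x.1,
    isPrim_mulVec _ x⟩
  one_smul x := Subtype.ext (by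
    change (Matrix.SpecialLinearGroup.map (Int.castRingHom (ZMod q)) 1).1.mulVec x.1 = x.1
    rw [map_one, Matrix.SpecialLinearGroup.coe_one, Matrix.one_mulVec])
  mul_smul γ δ x := Subtype.ext (by
    change (Matrix.SpecialLinearGroup.map (Int.castRingHom (ZMod q)) (γ * δ)).1.mulVec x.1 =
      (Matrix.SpecialLinearGroup.map (Int.castRingHom (ZMod q)) γ).1.mulVec
        ((Matrix.SpecialLinearGroup.map (Int.castRingHom (ZMod q)) δ).1.mulVec x.1)
    rw [map_mul, Matrix.SpecialLinearGroup.coe_mul, Matrix.mulVec_mulVec])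

/-- The units of `ℤ/qℤ` act on primitive vectors by scalar multiplication. -/
instance instMulActionUnits (n q : ℕ) : MulAction (ZMod q)ˣ (PrimVec n q) where
  smul u x := ⟨(u : ZMod q) • x.1, isPrim_units_smul u x⟩
  one_smul x := Subtype.ext (by
    change ((1 : (ZMod q)ˣ) : ZMod q) • x.1 = x.1
    rw [Units.val_one, one_smul])
  mul_smul u v x := Subtype.ext (by
    change ((u * v : (ZMod q)ˣ) : ZMod q) • x.1 = (u : ZMod q) • ((v : ZMod q) • x.1)
    rw [Units.val_mul, mul_smul])

instance instSMulCommClass (n q : ℕ) : SMulCommClass SL(n, ℤ) (ZMod q)ˣ (PrimVec n q) where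
  smul_comm γ u x := Subtype.ext (Matrix.mulVec_smul
    (Matrix.SpecialLinearGroup.map (Int.castRingHom (ZMod q)) γ).1 (u : ZMod q) x.1)

end PrimVec

/-- Projective space modulo `q`: the primitive vectors modulo multiplication by the units of
`ℤ/qℤ`. -/
def ProjSpace (n q : ℕ) : Type :=
  MulAction.orbitRel.Quotient (ZMod q)ˣ (PrimVec n q)

/-- The action of `SLₙ(ℤ)` induced on projective space: `γ • [x] = [γ • x]`. -/
instance ProjSpace.instMulActionSL (n q : ℕ) : MulAction SL(n, ℤ) (ProjSpace n q) where
  smul γ := Quotient.map (γ • ·) (by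
    rintro x y ⟨u, rfl⟩
    exact ⟨u, (smul_comm γ u y).symm⟩)
  one_smul p := Quotient.inductionOn p fun x => congrArg (Quotient.mk _) (one_smul _ x)
  mul_smul γ δ p := Quotient.inductionOn p fun x => congrArg (Quotient.mk _) (mul_smul γ δ x)

noncomputable section

/-- The operator norm of `γ ∈ SLₙ(ℤ)` acting on Euclidean space `ℝⁿ`. -/
def slNorm {n : ℕ} (γ : SL(n, ℤ)) : ℝ :=
  ‖Matrix.toEuclideanCLM (n := Fin n) (𝕜 := ℝ) (γ.1.map (Int.cast : ℤ → ℝ))‖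

/-- `d(x, y) = min {log ‖γ‖ : γ ∈ SLₙ(ℤ), γ • x = y}`, as an extended real number; its value is `⊤`
if no `γ` takes `x` to `y`. -/
def slDist (n : ℕ) {X : Type} [MulAction SL(n, ℤ) X] (x y : X) : EReal :=
  ⨅ (γ : SL(n, ℤ)) (_ : γ • x = y), (Real.log (slNorm γ) : EReal)

/-- The normalized diameter `max {d(x, y) / log q : x, y ∈ X}`. -/
def diamExp (n : ℕ) (X : Type) [MulAction SL(n, ℤ) X] (q : ℕ) : EReal :=
  ⨆ (x : X) (y : X), slDist n x y / (Real.log q : EReal)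

/-- `limsup` of the normalized diameter of the space of primitive vectors as `q → ∞`. -/
def limsupAffine (n : ℕ) : EReal :=
  Filter.limsup (fun q : ℕ => diamExp n (PrimVec n q) q) Filter.atTop

/-- `liminf` of the normalized diameter of the space of primitive vectors as `q → ∞`. -/
def liminfAffine (n : ℕ) : EReal :=
  Filter.liminf (fun q : ℕ => diamExp n (PrimVec n q) q) Filter.atTop

/-- `limsup` of the normalized diameter of projective space as `q → ∞`. -/
def limsupProj (n : ℕ) : EReal :=
  Filter.limsup (fun q : ℕ => diamExp n (ProjSpace n q) q) Filter.atTop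

/-- `liminf` of the normalized diameter of projective space as `q → ∞`. -/
def liminfProj (n : ℕ) : EReal :=
  Filter.liminf (fun q : ℕ => diamExp n (ProjSpace n q) q) Filter.atTop

end

/-! The norm of an integer matrix equals its largest entry up to a factor `n`, and `2 ^ ω(m)` is `m
^ o(1)`, so such factors do not affect exponents. By `exists_avoiding`, one class modulo each prime
divisor of `N` can be avoided by an integer of size `2 ^ ω(N)`. Hence coordinates become units and
pairs of integers become coprime at cost `q ^ o(1)`.

Upper bounds: once coordinate `i` of `x` and `y` is a unit, replacing column `i` of the identity by
a vector `v` with `v i = 1` and entries below `q` takes `x` to a unit multiple of `y`; this settles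
`P_q`. To reach `y` itself, `v i` must be free, so a second column has to restore the determinant;
it does no harm if the matching coordinate of `x` is `0` (`cornerCol_smul`). A primitive integer
relation `r · x ≡ 0` of size `R` produces such a zero at cost `R`, for a total of `R * q ^ (1 +
o(1))`. Pigeonhole gives `R ≤ q ^ (1/n)` for prime `q`, which suffices for the liminf. For general
`q`, two independent relations of size `q ^ (1/(n-1))` are saturated and combined into a primitive
one (`exists_saturated_pair`, `exists_short_primitive_relation`).

Lower bounds: if `γ` maps `eᵢ` to `y`, column `i` of `γ` reduces to `y`. A coordinate `⌊q/2⌋` forces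
an entry of that size, also projectively when `q` is even. For the projective liminf, `(2B+1) ^ n`
short columns cannot reach `q ^ (n-1)` points. -/

/-! ### Avoiding one residue class modulo each prime divisor -/

/-- An exponential sum with `|T|` terms that vanishes at `0, …, |T| - 1` vanishes everywhere. -/
theorem expSum_eq_zero_of_initial {ι R : Type*} [CommRing R] (T : Finset ι) (c lam : ι → R)
    (h : ∀ k < T.card, ∑ s ∈ T, c s * lam s ^ k = 0) (k : ℕ) :
    ∑ s ∈ T, c s * lam s ^ k = 0 := by
  classical
  induction T using Finset.induction_on generalizing c k with
  | empty => simp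
  | insert a T ha ih =>
    -- Applying `f(k+1) - lam a * f(k)` removes the frequency `lam a` and leaves a sum over `T`.
    have key : ∀ k, ∑ s ∈ insert a T, c s * lam s ^ (k + 1)
        = lam a * (∑ s ∈ insert a T, c s * lam s ^ k)
          + ∑ s ∈ T, c s * (lam s - lam a) * lam s ^ k := by
      intro k
      rw [Finset.sum_insert ha, Finset.sum_insert ha, mul_add, Finset.mul_sum, add_assoc,
        ← Finset.sum_add_distrib]
      congr 1
      · ring
      · exact Finset.sum_congr rfl fun s _ => by ring
    have hg : ∀ k, ∑ s ∈ T, c s * (lam s - lam a) * lam s ^ k = 0 := by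
      refine ih (fun s => c s * (lam s - lam a)) ?_
      intro k hk
      have h1 := h (k + 1) (by rw [Finset.card_insert_of_notMem ha]; omega)
      have h0 := h k (by rw [Finset.card_insert_of_notMem ha]; omega)
      rw [key, h0, mul_zero, zero_add] at h1
      exact h1
    induction k with
    | zero => exact h 0 (by rw [Finset.card_insert_of_notMem ha]; omega)
    | succ k ihk => rw [key, ihk, hg, mul_zero, add_zero]

/-- Among `2 ^ |S|` consecutive integers, one avoids a given residue class modulo each of the
primes in `S`. -/
theorem exists_lt_two_pow_not_dvd (S : Finset ℕ) (hS : ∀ p ∈ S, p.Prime) (e : ℕ → ℕ) :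
    ∃ k < 2 ^ S.card, ∀ p ∈ S, ¬ p ∣ k + e p := by
  classical
  -- `∏ (1 - z p ^ (k + e p))` vanishes exactly when some `p` divides `k + e p`, and expands into `2
  -- ^ |S|` exponentials in `k`. Vanishing on the initial segment would make it vanish everywhere,
  -- which the Chinese remainder theorem refutes.
  by_contra! hcon
  let z : ℕ → ℂ := fun p => Complex.exp (2 * Real.pi * Complex.I / p)
  have hz : ∀ p ∈ S, ∀ m, z p ^ m = 1 ↔ p ∣ m := fun p hp m =>
    (Complex.isPrimitiveRoot_exp p (hS p hp).ne_zero).pow_eq_one_iff_dvd m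
  have hexp : ∀ k, ∏ p ∈ S, (1 - z p ^ (k + e p)) =
      ∑ A ∈ S.powerset, (∏ p ∈ A, -(z p ^ e p)) * (∏ p ∈ A, z p) ^ k := by
    intro k
    have : ∀ p ∈ S, 1 - z p ^ (k + e p) = 1 + (-(z p ^ e p)) * z p ^ k := fun p _ => by ring
    rw [Finset.prod_congr rfl this, Finset.prod_one_add]
    refine Finset.sum_congr rfl fun A _ => ?_
    rw [Finset.prod_mul_distrib, Finset.prod_pow]
  have hzero : ∀ k, ∏ p ∈ S, (1 - z p ^ (k + e p)) = 0 := by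
    intro k
    rw [hexp]
    refine expSum_eq_zero_of_initial _ _ _ (fun k hk => ?_) k
    rw [Finset.card_powerset] at hk
    obtain ⟨p, hp, hd⟩ := hcon k hk
    rw [← hexp]
    exact Finset.prod_eq_zero hp (by rw [(hz p hp _).2 hd, sub_self])
  -- The residue is `1 - e p` modulo `p`, written without subtracting `e p` in `ℕ`.
  obtain ⟨k, hk⟩ := Nat.chineseRemainderOfFinset (fun p => 1 + (p - 1) * e p) id S
    (fun p hp => (hS p hp).ne_zero)
    (fun p hp r hr hpr => (Nat.coprime_primes (hS p hp) (hS r hr)).2 hpr)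
  obtain ⟨p, hp, h0⟩ := Finset.prod_eq_zero_iff.1 (hzero k)
  have hd : p ∣ k + e p := (hz p hp _).1 (sub_eq_zero.1 h0).symm
  have h1 : k + e p ≡ 1 [MOD p] := by
    have h2 := (hk p hp).add_right (e p)
    have h3 : 1 + (p - 1) * e p + e p = 1 + p * e p := by
      obtain ⟨m, hm⟩ := Nat.exists_eq_succ_of_ne_zero (hS p hp).ne_zero
      subst hm
      simp only [Nat.succ_eq_add_one, Nat.add_sub_cancel]
      ring
    rw [h3] at h2
    refine h2.trans ?_
    simp [Nat.ModEq]
  have h4 : p ∣ 1 := (Nat.modEq_zero_iff_dvd).1 (h1.symm.trans ((Nat.modEq_zero_iff_dvd).2 hd))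
  exact (hS p hp).one_lt.ne' (Nat.dvd_one.1 h4)

/-- A version of `exists_lt_two_pow_not_dvd` for predicates that hold on at most one residue class
modulo each prime divisor of `N`. -/
theorem exists_avoiding (N : ℕ) (Bad : ℕ → ℤ → Prop)
    (h : ∀ p ∈ N.primeFactors, ∀ k l, Bad p k → Bad p l → (p : ℤ) ∣ k - l) :
    ∃ k : ℤ, 0 ≤ k ∧ k ≤ 2 ^ N.primeFactors.card ∧ ∀ p ∈ N.primeFactors, ¬ Bad p k := by
  classical
  have hc : ∀ p : ℕ, ∃ e : ℕ, p ∈ N.primeFactors → ∀ k : ℕ, Bad p k → p ∣ k + e := by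
    intro p
    by_cases hp : p ∈ N.primeFactors ∧ ∃ c, Bad p c
    · obtain ⟨hp, c, hc⟩ := hp
      have hp0 : (p : ℤ) ≠ 0 := by exact_mod_cast (Nat.prime_of_mem_primeFactors hp).ne_zero
      refine ⟨((-c) % p).toNat, fun _ k hk => ?_⟩
      have h1 := h p hp k c hk hc
      have h2 : (((-c) % p).toNat : ℤ) = (-c) % p := Int.toNat_of_nonneg (Int.emod_nonneg _ hp0)
      zify
      rw [h2, Int.dvd_iff_emod_eq_zero, Int.add_emod_emod, ← sub_eq_add_neg]
      exact Int.emod_eq_zero_of_dvd h1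
    · refine ⟨0, fun hp' k hk => (hp ⟨hp', _, hk⟩).elim⟩
  choose e he using hc
  obtain ⟨k, hk, hk'⟩ := exists_lt_two_pow_not_dvd N.primeFactors
    (fun p hp => Nat.prime_of_mem_primeFactors hp) e
  exact ⟨k, by positivity, by exact_mod_cast hk.le, fun p hp hb => hk' p hp (he p hp k hb)⟩

/-- `2 ^ ω(m) = O(m ^ ε)`. -/
theorem exists_two_pow_card_primeFactors_le {ε : ℝ} (hε : 0 < ε) :
    ∃ C : ℝ, 1 ≤ C ∧ ∀ m : ℕ, m ≠ 0 → (2 : ℝ) ^ m.primeFactors.card ≤ C * (m : ℝ) ^ ε := by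
  -- Primes `p ≥ B` satisfy `2 ≤ p ^ ε`; those below `B` contribute at most `2 ^ B`.
  obtain ⟨B, hB⟩ := exists_nat_gt ((2 : ℝ) ^ ε⁻¹)
  have hlarge : ∀ p : ℕ, B ≤ p → (2 : ℝ) ≤ (p : ℝ) ^ ε := by
    intro p hp
    have h1 : (2 : ℝ) ^ ε⁻¹ ≤ p := hB.le.trans (by exact_mod_cast hp)
    calc (2 : ℝ) = ((2 : ℝ) ^ ε⁻¹) ^ ε := by
          rw [← Real.rpow_mul (by norm_num), inv_mul_cancel₀ hε.ne', Real.rpow_one]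
      _ ≤ _ := Real.rpow_le_rpow (by positivity) h1 hε.le
  refine ⟨2 ^ B, one_le_pow₀ (by norm_num), fun m hm => ?_⟩
  have hsplit := Finset.card_filter_add_card_filter_not (s := m.primeFactors) (fun p => p < B)
  have h1 : (m.primeFactors.filter (fun p => p < B)).card ≤ B := by
    calc _ ≤ (Finset.range B).card := Finset.card_le_card fun p hp => by
          simpa using (Finset.mem_filter.1 hp).2
      _ = B := Finset.card_range B
  rw [← hsplit, pow_add]
  refine mul_le_mul (pow_le_pow_right₀ (by norm_num) h1) ?_ (by positivity) (by positivity)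
  calc (2 : ℝ) ^ (m.primeFactors.filter (fun p => ¬ p < B)).card
      = ∏ p ∈ m.primeFactors.filter (fun p => ¬ p < B), 2 := by rw [Finset.prod_const]
    _ ≤ ∏ p ∈ m.primeFactors.filter (fun p => ¬ p < B), (p : ℝ) ^ ε :=
        Finset.prod_le_prod (fun _ _ => by norm_num) fun p hp =>
          hlarge p (not_lt.1 (Finset.mem_filter.1 hp).2)
    _ ≤ ∏ p ∈ m.primeFactors, (p : ℝ) ^ ε := by
        rw [← Finset.prod_filter_mul_prod_filter_not m.primeFactors (fun p => p < B)
          (fun p => (p : ℝ) ^ ε)]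
        refine le_mul_of_one_le_left (Finset.prod_nonneg fun _ _ => by positivity)
          (Finset.prod_induction _ (1 ≤ ·) (fun _ _ => one_le_mul_of_one_le_of_one_le) le_rfl
            fun p hp => Real.one_le_rpow ?_ hε.le)
        exact_mod_cast (Nat.prime_of_mem_primeFactors (Finset.mem_filter.1 hp).1).one_le
    _ = (∏ p ∈ m.primeFactors, (p : ℝ)) ^ ε :=
        Real.finsetProd_rpow _ _ (fun _ _ => by positivity) _
    _ ≤ (m : ℝ) ^ ε := by
        refine Real.rpow_le_rpow (by positivity) ?_ hε.le
        rw [← Nat.cast_prod]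
        exact_mod_cast Nat.le_of_dvd (Nat.pos_of_ne_zero hm) (Nat.prod_primeFactors_dvd m)

theorem two_pow_card_primeFactors_le {m : ℕ} (hm : m ≠ 0) : 2 ^ m.primeFactors.card ≤ m := by
  calc 2 ^ m.primeFactors.card = ∏ p ∈ m.primeFactors, 2 := by rw [Finset.prod_const]
    _ ≤ ∏ p ∈ m.primeFactors, p :=
        Finset.prod_le_prod' fun p hp => (Nat.prime_of_mem_primeFactors hp).two_le
    _ ≤ m := Nat.le_of_dvd (Nat.pos_of_ne_zero hm) (Nat.prod_primeFactors_dvd m)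

/-- A small integer combination of the `a l`, with coefficient `1` at `i`, that is nonzero modulo
every prime divisor of `N` modulo which some `a l` is nonzero. -/
theorem exists_small_combination {ι : Type*} [Fintype ι] (N : ℕ) (a : ι → ℤ) (i : ι) :
    ∃ k : ι → ℤ, k i = 1 ∧ (∀ l, |k l| ≤ 2 ^ N.primeFactors.card) ∧
      ∀ p ∈ N.primeFactors, (∃ l, ¬ (p : ℤ) ∣ a l) → ¬ (p : ℤ) ∣ ∑ l, k l * a l := by
  classical
  have main : ∀ S : Finset ι, i ∉ S → ∃ k : ι → ℤ, (∀ l, |k l| ≤ 2 ^ N.primeFactors.card) ∧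
      ∀ p ∈ N.primeFactors, (∃ l ∈ insert i S, ¬ (p : ℤ) ∣ a l) →
        ¬ (p : ℤ) ∣ a i + ∑ l ∈ S, k l * a l := by
    intro S
    induction S using Finset.induction_on with
    | empty =>
      intro _
      exact ⟨0, fun l => by simp, fun p _ => by simp⟩
    | insert j S hj ih =>
      intro hi
      obtain ⟨k, hk, hkp⟩ := ih (fun h => hi (Finset.mem_insert_of_mem h))
      -- If `p ∣ a j`, the choice of `t` is irrelevant modulo `p` and the induction hypothesis
      -- decides; otherwise just one class of `t` is bad.
      obtain ⟨t, ht0, ht1, ht⟩ := exists_avoiding N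
        (fun p t => ¬ (p : ℤ) ∣ a j ∧ (p : ℤ) ∣ t * a j + (a i + ∑ l ∈ S, k l * a l)) (by
          rintro p hp t t' ⟨h1, h2⟩ ⟨-, h3⟩
          have h4 : (p : ℤ) ∣ (t - t') * a j := by
            have := dvd_sub h2 h3
            rwa [add_sub_add_right_eq_sub, ← sub_mul] at this
          exact ((Nat.prime_iff_prime_int.1 (Nat.prime_of_mem_primeFactors hp)).dvd_or_dvd
            h4).resolve_right h1)
      refine ⟨Function.update k j t, fun l => ?_, fun p hp hl => ?_⟩
      · by_cases h : l = j
        · subst h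
          rw [Function.update_self, abs_of_nonneg ht0]
          exact ht1
        · rw [Function.update_of_ne h]
          exact hk l
      · have hsum : ∑ l ∈ insert j S, Function.update k j t l * a l
            = t * a j + ∑ l ∈ S, k l * a l := by
          rw [Finset.sum_insert hj, Function.update_self]
          congr 1
          refine Finset.sum_congr rfl fun l hl => ?_
          rw [Function.update_of_ne (ne_of_mem_of_not_mem hl hj)]
        rw [hsum, add_left_comm]
        by_cases hja : (p : ℤ) ∣ a j
        · intro hd
          have := (dvd_add_right (dvd_mul_of_dvd_right hja t)).1 hd
          refine hkp p hp ?_ this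
          obtain ⟨l, hl, hla⟩ := hl
          refine ⟨l, ?_, hla⟩
          rw [Finset.mem_insert, Finset.mem_insert] at hl
          rw [Finset.mem_insert]
          rcases hl with h | h | h
          · exact Or.inl h
          · exact (hla (h ▸ hja)).elim
          · exact Or.inr h
        · exact fun hd => ht p hp ⟨hja, hd⟩
  obtain ⟨k, hk, hkp⟩ := main (Finset.univ.erase i) (Finset.notMem_erase _ _)
  refine ⟨Function.update k i 1, Function.update_self .., fun l => ?_, fun p hp hl => ?_⟩
  · by_cases h : l = i
    · subst h
      rw [Function.update_self, abs_one]
      exact one_le_pow₀ (by norm_num)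
    · rw [Function.update_of_ne h]
      exact hk l
  · have hsum : ∑ l, Function.update k i 1 l * a l
        = a i + ∑ l ∈ Finset.univ.erase i, k l * a l := by
      rw [← Finset.add_sum_erase _ _ (Finset.mem_univ i), Function.update_self, one_mul]
      congr 1
      refine Finset.sum_congr rfl fun l hl => ?_
      rw [Function.update_of_ne (Finset.ne_of_mem_erase hl)]
    rw [hsum]
    refine hkp p hp ?_
    obtain ⟨l, hl⟩ := hl
    exact ⟨l, by simp, hl⟩

/-- Bézout coefficients of controlled size. -/
theorem exists_bezout_le {a b : ℤ} (h : IsCoprime a b) :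
    ∃ c d : ℤ, a * d - b * c = 1 ∧ |c| ≤ |a| + |b| + 1 ∧ |d| ≤ |a| + |b| + 1 := by
  obtain ⟨u, v, huv⟩ := h
  by_cases hb : b = 0
  · subst hb
    have ha : IsUnit a := IsUnit.of_mul_eq_one u (by linarith)
    rcases Int.isUnit_iff.1 ha with rfl | rfl
    · exact ⟨0, 1, by norm_num⟩
    · exact ⟨0, -1, by norm_num⟩
  · have hd0 := Int.emod_nonneg u hb
    have hd1 := Int.emod_lt_abs u hb
    -- Reducing `u` modulo `b` bounds `d`; the equation `b * c = a * d - 1` then bounds `c`.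
    have hdiv : a * (u % b) - b * (-v - a * (u / b)) = 1 := by
      have := Int.emod_add_mul_ediv u b
      linear_combination huv + a * this
    refine ⟨-v - a * (u / b), u % b, hdiv, ?_, ?_⟩
    · set c := -v - a * (u / b)
      have hbc : |b| * |c| ≤ |a| * |b| + 1 := by
        rw [← abs_mul]
        have : b * c = a * (u % b) - 1 := by linarith
        rw [this]
        refine (abs_sub _ _).trans ?_
        rw [abs_mul, abs_one, abs_of_nonneg hd0]
        gcongr
      have hb1 : 1 ≤ |b| := Int.one_le_abs hb
      nlinarith [abs_nonneg a, abs_nonneg c]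
    · rw [abs_of_nonneg hd0]
      have := abs_nonneg a
      linarith

/-! ### The operator norm -/

theorem slNorm_nonneg {n : ℕ} (γ : SL(n, ℤ)) : 0 ≤ slNorm γ := norm_nonneg _

theorem slNorm_mul_le {n : ℕ} (γ δ : SL(n, ℤ)) : slNorm (γ * δ) ≤ slNorm γ * slNorm δ := by
  unfold slNorm
  have : ((γ * δ).1.map (Int.cast : ℤ → ℝ)) =
      (γ.1.map (Int.cast : ℤ → ℝ)) * (δ.1.map (Int.cast : ℤ → ℝ)) := by
    rw [Matrix.SpecialLinearGroup.coe_mul]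
    exact Matrix.map_mul (f := Int.castRingHom ℝ)
  rw [this, map_mul]
  exact norm_mul_le _ _

theorem abs_entry_le_slNorm {n : ℕ} (γ : SL(n, ℤ)) (i j : Fin n) :
    |(γ.1 i j : ℝ)| ≤ slNorm γ := by
  have h1 := (Matrix.toEuclideanCLM (n := Fin n) (𝕜 := ℝ)
    (γ.1.map (Int.cast : ℤ → ℝ))).le_opNorm (EuclideanSpace.single j (1 : ℝ))
  rw [EuclideanSpace.single, PiLp.norm_single, norm_one, mul_one] at h1
  refine le_trans ?_ h1
  refine le_trans (le_of_eq ?_) (PiLp.norm_apply_le _ i)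
  rw [Real.norm_eq_abs]
  congr 1
  simp [Matrix.ofLp_toEuclideanCLM]

theorem slNorm_le_of_entries {n : ℕ} (γ : SL(n, ℤ)) {B : ℝ} (hB : 0 ≤ B)
    (h : ∀ i j, |(γ.1 i j : ℝ)| ≤ B) : slNorm γ ≤ n * B := by
  refine ContinuousLinearMap.opNorm_le_bound _ (by positivity) fun v => ?_
  rw [← sq_le_sq₀ (norm_nonneg _) (by positivity), EuclideanSpace.norm_sq_eq, mul_pow,
    EuclideanSpace.norm_sq_eq]
  have hrow : ∀ i, ‖(Matrix.toEuclideanCLM (n := Fin n) (𝕜 := ℝ)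
      (γ.1.map (Int.cast : ℤ → ℝ)) v) i‖ ^ 2 ≤ (n * B ^ 2) * ∑ j, ‖v j‖ ^ 2 := by
    intro i
    rw [Matrix.ofLp_toEuclideanCLM]
    simp only [Matrix.mulVec, dotProduct, Matrix.map_apply, Real.norm_eq_abs, sq_abs]
    refine (Finset.sum_mul_sq_le_sq_mul_sq _ _ _).trans ?_
    refine mul_le_mul_of_nonneg_right ?_ (Finset.sum_nonneg fun _ _ => sq_nonneg _)
    calc ∑ j, (γ.1 i j : ℝ) ^ 2 ≤ ∑ _j : Fin n, B ^ 2 :=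
          Finset.sum_le_sum fun j _ => by
            rw [← sq_abs]
            exact pow_le_pow_left₀ (abs_nonneg _) (h i j) 2
      _ = n * B ^ 2 := by simp
  calc _ ≤ ∑ _i : Fin n, (n * B ^ 2) * ∑ j, ‖v j‖ ^ 2 := Finset.sum_le_sum fun i _ => hrow i
    _ = _ := by
      rw [Finset.sum_const, Finset.card_univ, Fintype.card_fin, nsmul_eq_mul]
      ring

/-! ### Matrices that differ from the identity in one or two columns -/

theorem PrimVec.smul_apply {n q : ℕ} (γ : SL(n, ℤ)) (x : PrimVec n q) (l : Fin n) :
    (γ • x).1 l = ∑ m, (γ.1 l m : ZMod q) * x.1 m := rfl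

/-- The identity matrix with column `i` replaced by `v`, where `v i = 1`. -/
def colOp {n : ℕ} (i : Fin n) (v : Fin n → ℤ) (h : v i = 1) : SL(n, ℤ) :=
  ⟨(1 : Matrix (Fin n) (Fin n) ℤ).updateCol i v, by
    rw [← Matrix.cramer_apply, Matrix.cramer_one]
    exact h⟩

/-- Linearity in column `j`: the `eⱼ` part leaves the identity with column `i` replaced, of
determinant `v i`; the `eᵢ` part is, after swapping two columns, the identity with column `j`
replaced, which gives `-v j`. -/
theorem det_cornerCol {n : ℕ} {i j : Fin n} (hij : i ≠ j) (v : Fin n → ℤ) (b d : ℤ) :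
    (((1 : Matrix (Fin n) (Fin n) ℤ).updateCol i v).updateCol j
      (b • Pi.single i 1 + d • Pi.single j 1)).det = v i * d - v j * b := by
  rw [Matrix.det_updateCol_add, Matrix.det_updateCol_smul, Matrix.det_updateCol_smul]
  have h1 : ((1 : Matrix (Fin n) (Fin n) ℤ).updateCol i v).updateCol j (Pi.single j 1)
      = (1 : Matrix (Fin n) (Fin n) ℤ).updateCol i v := by
    ext l m
    by_cases hm : m = j
    · subst hm
      simp [hij.symm, Matrix.one_apply, Pi.single_apply]
    · simp [Matrix.updateCol_apply, hm]
  have h2 : ((1 : Matrix (Fin n) (Fin n) ℤ).updateCol i v).updateCol j (Pi.single i 1)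
      = ((1 : Matrix (Fin n) (Fin n) ℤ).updateCol j v).submatrix id (Equiv.swap i j) := by
    ext l m
    by_cases hm : m = j
    · subst hm
      simp [hij, Matrix.one_apply, Pi.single_apply]
    · by_cases hmi : m = i
      · subst hmi
        simp [hij]
      · simp [hm, hmi, Equiv.swap_apply_of_ne_of_ne hmi hm]
  rw [h1, h2, Matrix.det_permute', Equiv.Perm.sign_swap hij, ← Matrix.cramer_apply,
    ← Matrix.cramer_apply, Matrix.cramer_one]
  simp
  ring

/-- The identity matrix with column `i` replaced by `v` and column `j` replaced by
`b eᵢ + d eⱼ`. -/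
def cornerCol {n : ℕ} {i j : Fin n} (hij : i ≠ j) (v : Fin n → ℤ) (b d : ℤ)
    (h : v i * d - v j * b = 1) : SL(n, ℤ) :=
  ⟨((1 : Matrix (Fin n) (Fin n) ℤ).updateCol i v).updateCol j
      (b • Pi.single i 1 + d • Pi.single j 1), by rw [det_cornerCol hij, h]⟩

theorem abs_colOp_le {n : ℕ} {i : Fin n} {v : Fin n → ℤ} (h : v i = 1) {B : ℝ}
    (hB : ∀ l, |(v l : ℝ)| ≤ B) (l m : Fin n) : |((colOp i v h).1 l m : ℝ)| ≤ B := by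
  have h1 : (1 : ℝ) ≤ B := by simpa [h] using hB i
  change |(((1 : Matrix (Fin n) (Fin n) ℤ).updateCol i v l m : ℤ) : ℝ)| ≤ B
  rw [Matrix.updateCol_apply]
  split_ifs
  · exact hB l
  · rw [Matrix.one_apply]
    split_ifs
    · simpa using h1
    · simpa using zero_le_one.trans h1

theorem abs_cornerCol_le {n : ℕ} {i j : Fin n} (hij : i ≠ j) {v : Fin n → ℤ} {b d : ℤ}
    (h : v i * d - v j * b = 1) {B : ℝ} (h1 : 1 ≤ B) (hB : ∀ l, |(v l : ℝ)| ≤ B)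
    (hb : |(b : ℝ)| ≤ B) (hd : |(d : ℝ)| ≤ B) (l m : Fin n) :
    |((cornerCol hij v b d h).1 l m : ℝ)| ≤ B := by
  have h0 : (0 : ℝ) ≤ B := zero_le_one.trans h1
  change |((((1 : Matrix (Fin n) (Fin n) ℤ).updateCol i v).updateCol j
      (b • Pi.single i 1 + d • Pi.single j 1) l m : ℤ) : ℝ)| ≤ B
  rw [Matrix.updateCol_apply, Matrix.updateCol_apply]
  split_ifs
  · by_cases hl : l = i
    · subst hl
      simpa [hij] using hb
    · by_cases hl' : l = j
      · subst hl'
        simpa [hl] using hd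
      · simpa [hl, hl'] using h0
  · exact hB l
  · rw [Matrix.one_apply]
    split_ifs
    · simpa using h1
    · simpa using h0

theorem colOp_smul {n q : ℕ} {i : Fin n} {v : Fin n → ℤ} (h : v i = 1) (x : PrimVec n q)
    (l : Fin n) :
    (colOp i v h • x).1 l = v l * x.1 i + if l = i then 0 else x.1 l := by
  rw [PrimVec.smul_apply]
  change ∑ m, (((1 : Matrix (Fin n) (Fin n) ℤ).updateCol i v l m : ℤ) : ZMod q) * x.1 m = _
  rw [← Finset.add_sum_erase _ _ (Finset.mem_univ i)]
  congr 1
  · simp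
  · have : ∀ m ∈ Finset.univ.erase i,
        (((1 : Matrix (Fin n) (Fin n) ℤ).updateCol i v l m : ℤ) : ZMod q) * x.1 m
          = if l = m then x.1 m else 0 := by
      intro m hm
      rw [Matrix.updateCol_apply, if_neg (Finset.ne_of_mem_erase hm), Matrix.one_apply]
      split_ifs <;> simp
    rw [Finset.sum_congr rfl this, Finset.sum_ite_eq]
    by_cases hl : l = i <;> simp [hl]

theorem rowOp_smul_self {n q : ℕ} {i : Fin n} {v : Fin n → ℤ} (h : v i = 1) (x : PrimVec n q) :
    ((colOp i v h).transpose • x).1 i = ∑ m, (v m : ZMod q) * x.1 m := by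
  rw [PrimVec.smul_apply]
  refine Finset.sum_congr rfl fun m _ => ?_
  change (((1 : Matrix (Fin n) (Fin n) ℤ).updateCol i v m i : ℤ) : ZMod q) * x.1 m = _
  rw [Matrix.updateCol_apply, if_pos rfl]

theorem rowOp_smul_of_ne {n q : ℕ} {i : Fin n} {v : Fin n → ℤ} (h : v i = 1) (x : PrimVec n q)
    {l : Fin n} (hl : l ≠ i) : ((colOp i v h).transpose • x).1 l = x.1 l := by
  rw [PrimVec.smul_apply]
  have : ∀ m, (((colOp i v h).transpose.1 l m : ℤ) : ZMod q) * x.1 m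
      = if m = l then x.1 m else 0 := by
    intro m
    change (((1 : Matrix (Fin n) (Fin n) ℤ).updateCol i v m l : ℤ) : ZMod q) * x.1 m = _
    rw [Matrix.updateCol_apply, if_neg hl, Matrix.one_apply]
    split_ifs <;> simp
  rw [Finset.sum_congr rfl fun m _ => this m]
  simp

theorem cornerRow_smul {n q : ℕ} {i j : Fin n} (hij : i ≠ j) {v : Fin n → ℤ} {b d : ℤ}
    (h : v i * d - v j * b = 1) (x : PrimVec n q) :
    ((cornerCol hij v b d h).transpose • x).1 i = ∑ m, (v m : ZMod q) * x.1 m := by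
  rw [PrimVec.smul_apply]
  refine Finset.sum_congr rfl fun m _ => ?_
  change ((((1 : Matrix (Fin n) (Fin n) ℤ).updateCol i v).updateCol j
      (b • Pi.single i 1 + d • Pi.single j 1) m i : ℤ) : ZMod q) * x.1 m = _
  rw [Matrix.updateCol_apply, if_neg hij, Matrix.updateCol_apply, if_pos rfl]

/-- Column `j` only corrects the determinant. It is multiplied by `x j = 0`, so `b` and `d` leave no
trace. -/
theorem cornerCol_smul {n q : ℕ} {i j : Fin n} (hij : i ≠ j) {v : Fin n → ℤ} {b d : ℤ}
    (h : v i * d - v j * b = 1) (x : PrimVec n q) (hx : x.1 j = 0) (l : Fin n) :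
    (cornerCol hij v b d h • x).1 l = v l * x.1 i + if l = i then 0 else x.1 l := by
  rw [PrimVec.smul_apply]
  change ∑ m, ((((1 : Matrix (Fin n) (Fin n) ℤ).updateCol i v).updateCol j
      (b • Pi.single i 1 + d • Pi.single j 1) l m : ℤ) : ZMod q) * x.1 m = _
  rw [← Finset.add_sum_erase _ _ (Finset.mem_univ i)]
  congr 1
  · simp [hij]
  · have : ∀ m ∈ Finset.univ.erase i,
        ((((1 : Matrix (Fin n) (Fin n) ℤ).updateCol i v).updateCol j
          (b • Pi.single i 1 + d • Pi.single j 1) l m : ℤ) : ZMod q) * x.1 m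
          = if l = m then x.1 m else 0 := by
      intro m hm
      by_cases hmj : m = j
      · rw [hmj, hx]
        simp
      · rw [Matrix.updateCol_apply, if_neg hmj, Matrix.updateCol_apply,
          if_neg (Finset.ne_of_mem_erase hm), Matrix.one_apply]
        split_ifs <;> simp
    rw [Finset.sum_congr rfl this, Finset.sum_ite_eq]
    by_cases hl : l = i <;> simp [hl]

/-! ### Making a coordinate invertible -/

theorem PrimVec.exists_not_dvd {n q : ℕ} (x : PrimVec n q) {p : ℕ} (hp : p.Prime) (hpq : p ∣ q) :
    ∃ l, ¬ (p : ℤ) ∣ ((x.1 l).val : ℤ) := by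
  by_contra! h
  have h1 : p ∣ Nat.gcd q (Finset.univ.gcd fun i => (x.1 i).val) :=
    Nat.dvd_gcd hpq (Finset.dvd_gcd fun l _ => by exact_mod_cast h l)
  rw [x.2] at h1
  exact hp.one_lt.ne' (Nat.dvd_one.1 h1)

theorem ZMod.isUnit_intCast_of_not_dvd {q : ℕ} (hq : q ≠ 0) {a : ℤ}
    (h : ∀ p ∈ q.primeFactors, ¬ (p : ℤ) ∣ a) : IsUnit (a : ZMod q) := by
  rw [ZMod.coe_int_isUnit_iff_isCoprime, Int.isCoprime_iff_gcd_eq_one, Int.gcd_comm]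
  refine Nat.coprime_of_dvd fun p hp h1 h2 => ?_
  refine h p ?_ (Int.natCast_dvd.2 ?_)
  · exact Nat.mem_primeFactors.2 ⟨hp, by simpa using h2, hq⟩
  · simpa using h1

/-- An explicit inverse on `x` with entries of the same size, so that undoing the operation is
equally cheap. -/
theorem rowOp_neg_smul {n q : ℕ} {i : Fin n} {k k' : Fin n → ℤ} (h : k i = 1) (h' : k' i = 1)
    (hk : ∀ l, l ≠ i → k' l = -k l) (x : PrimVec n q) :
    (colOp i k' h').transpose • (colOp i k h).transpose • x = x := by
  refine Subtype.ext (funext fun l => ?_)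
  by_cases hl : l = i
  · subst hl
    rw [rowOp_smul_self, ← Finset.add_sum_erase _ _ (Finset.mem_univ l), rowOp_smul_self,
      ← Finset.add_sum_erase _ _ (Finset.mem_univ l), h, h']
    have : ∀ m ∈ Finset.univ.erase l, (k' m : ZMod q) * ((colOp l k h).transpose • x).1 m
        = -((k m : ZMod q) * x.1 m) := by
      intro m hm
      rw [rowOp_smul_of_ne h x (Finset.ne_of_mem_erase hm), hk m (Finset.ne_of_mem_erase hm)]
      push_cast
      ring
    rw [Finset.sum_congr rfl this, Finset.sum_neg_distrib]
    push_cast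
    ring
  · rw [rowOp_smul_of_ne h' _ hl, rowOp_smul_of_ne h _ hl]

theorem slNorm_transpose_colOp_le {n : ℕ} {i : Fin n} {v : Fin n → ℤ} (h : v i = 1) {B : ℝ}
    (hB : ∀ l, |(v l : ℝ)| ≤ B) : slNorm (colOp i v h).transpose ≤ n * B :=
  slNorm_le_of_entries _ ((abs_nonneg _).trans (hB i)) fun l m => abs_colOp_le h hB m l

/-- Any coordinate of a primitive vector can be made invertible by a small row operation, whose
inverse is small as well. -/
theorem exists_smul_isUnit {n q : ℕ} (hq : q ≠ 0) (x : PrimVec n q) (i : Fin n) :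
    ∃ γ δ : SL(n, ℤ), δ • γ • x = x ∧ IsUnit ((γ • x).1 i) ∧
      (∀ l, l ≠ i → (γ • x).1 l = x.1 l) ∧
      slNorm γ ≤ n * 2 ^ q.primeFactors.card ∧ slNorm δ ≤ n * 2 ^ q.primeFactors.card := by
  have : NeZero q := ⟨hq⟩
  obtain ⟨k, hki, hk, hkp⟩ := exists_small_combination q (fun l => ((x.1 l).val : ℤ)) i
  have hk' : ∀ l, |(k l : ℝ)| ≤ 2 ^ q.primeFactors.card := fun l => by exact_mod_cast hk l
  let k' : Fin n → ℤ := fun l => if l = i then 1 else -k l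
  have hk'i : k' i = 1 := if_pos rfl
  have hk'b : ∀ l, |(k' l : ℝ)| ≤ 2 ^ q.primeFactors.card := by
    intro l
    by_cases hl : l = i
    · rw [hl, hk'i, Int.cast_one, abs_one]
      exact one_le_pow₀ (by norm_num)
    · have : k' l = -k l := if_neg hl
      rw [this, Int.cast_neg, abs_neg]
      exact hk' l
  refine ⟨(colOp i k hki).transpose, (colOp i k' hk'i).transpose,
    rowOp_neg_smul hki hk'i (fun l hl => if_neg hl) x, ?_,
    fun l hl => rowOp_smul_of_ne hki x hl, slNorm_transpose_colOp_le hki hk',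
    slNorm_transpose_colOp_le hk'i hk'b⟩
  rw [rowOp_smul_self]
  have := ZMod.isUnit_intCast_of_not_dvd hq fun p hp => hkp p hp
    (x.exists_not_dvd (Nat.prime_of_mem_primeFactors hp) (Nat.dvd_of_mem_primeFactors hp))
  simpa using this

/-! ### The upper bound for projective space -/

/-- Since `v i = 1`, coordinate `i` is kept, so the target must be `y` rescaled by `u = x i / y i`.
The column is `(u * y l - x l) / x i`, lifted to `[0, q)`. -/
theorem exists_unipotent_smul_eq {n q : ℕ} (hq : q ≠ 0) {x y : PrimVec n q} {i : Fin n}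
    (hx : IsUnit (x.1 i)) (hy : IsUnit (y.1 i)) :
    ∃ (γ : SL(n, ℤ)) (u : (ZMod q)ˣ), γ • x = u • y ∧ slNorm γ ≤ n * q := by
  have : NeZero q := ⟨hq⟩
  obtain ⟨a, ha⟩ := hx
  obtain ⟨b, hb⟩ := hy
  let w : Fin n → ZMod q := fun l => (a⁻¹ : (ZMod q)ˣ) * ((a * b⁻¹ : (ZMod q)ˣ) * y.1 l - x.1 l)
  let v : Fin n → ℤ := fun l => if l = i then 1 else ((w l).val : ℤ)
  have hvi : v i = 1 := if_pos rfl
  have hq1 : (1 : ℝ) ≤ q := by exact_mod_cast Nat.one_le_iff_ne_zero.2 hq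
  have hv : ∀ l, |(v l : ℝ)| ≤ q := by
    intro l
    by_cases hl : l = i
    · rw [hl, hvi]
      simpa using hq1
    · have : v l = ((w l).val : ℤ) := if_neg hl
      rw [this, Int.cast_natCast, Nat.abs_cast]
      exact_mod_cast (ZMod.val_lt (w l)).le
  refine ⟨colOp i v hvi, a * b⁻¹, Subtype.ext (funext fun l => ?_),
    slNorm_le_of_entries _ (by positivity) (abs_colOp_le hvi hv)⟩
  rw [colOp_smul]
  change _ = ((a * b⁻¹ : (ZMod q)ˣ) : ZMod q) * y.1 l
  by_cases hl : l = i
  · rw [hl, hvi, if_pos rfl, ← ha, ← hb, ← Units.val_mul, inv_mul_cancel_right]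
    simp
  · have : v l = ((w l).val : ℤ) := if_neg hl
    rw [this, if_neg hl, Int.cast_natCast, ZMod.natCast_zmod_val, ← ha, mul_comm, ← mul_assoc,
      Units.mul_inv, one_mul, sub_add_cancel]

theorem exists_smul_eq_units_smul {n q : ℕ} (hn : 0 < n) (hq : q ≠ 0) (x y : PrimVec n q) :
    ∃ (γ : SL(n, ℤ)) (u : (ZMod q)ˣ), γ • x = u • y ∧
      slNorm γ ≤ n ^ 3 * (2 ^ q.primeFactors.card) ^ 2 * q := by
  let i : Fin n := ⟨0, hn⟩
  obtain ⟨α, -, -, hαu, -, hα, -⟩ := exists_smul_isUnit hq x i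
  obtain ⟨β, β', hβ, hβu, -, -, hβ'⟩ := exists_smul_isUnit hq y i
  obtain ⟨γ, u, h, hγ⟩ := exists_unipotent_smul_eq hq hαu hβu
  refine ⟨β' * (γ * α), u, ?_, ?_⟩
  · rw [mul_smul, mul_smul, h, smul_comm, hβ]
  · refine (slNorm_mul_le _ _).trans ?_
    calc slNorm β' * slNorm (γ * α)
        ≤ (n * 2 ^ q.primeFactors.card) * ((n * q) * (n * 2 ^ q.primeFactors.card)) := by
          refine mul_le_mul hβ' ((slNorm_mul_le _ _).trans ?_) (slNorm_nonneg _) (by positivity)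
          exact mul_le_mul hγ hα (slNorm_nonneg _) (by positivity)
      _ = _ := by ring

/-! ### The upper bound for primitive vectors, given a short relation -/

/-- A vector with a vanishing coordinate can be moved to any other vector. -/
theorem exists_smul_eq_of_apply_eq_zero {n q : ℕ} (hq : 2 ≤ q) {x y : PrimVec n q} {i j : Fin n}
    (hij : i ≠ j) (hxj : x.1 j = 0) (hx : IsUnit (x.1 i)) (hy : IsUnit (y.1 i)) {W : ℝ}
    (hW : ∀ m : ℕ, m ≠ 0 → m ≤ q ^ 3 → (2 : ℝ) ^ m.primeFactors.card ≤ W) :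
    ∃ γ : SL(n, ℤ), γ • x = y ∧ slNorm γ ≤ n * (4 * q * W) := by
  have : NeZero q := ⟨by omega⟩
  obtain ⟨a, ha⟩ := hx
  -- The column modulo `q` that `cornerCol_smul` requires for the image to be `y`.
  let w : Fin n → ZMod q := fun l =>
    (a⁻¹ : (ZMod q)ˣ) * (y.1 l - if l = i then 0 else x.1 l)
  have hwu : IsUnit (w i) := by
    have : w i = (a⁻¹ : (ZMod q)ˣ) * y.1 i := by simp [w]
    rw [this]
    exact (Units.isUnit _).mul hy
  have hcop : ((w i).val).Coprime q := by
    rw [← ZMod.isUnit_iff_coprime, ZMod.natCast_zmod_val]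
    exact hwu
  have hwi0 : (w i).val ≠ 0 := by
    intro h
    rw [h, Nat.coprime_zero_left] at hcop
    omega
  -- The lift of `w i` is prime to `q`, so shifting the lift of `w j` by multiples of `q` hits one
  -- bad class modulo each of its prime divisors. Avoiding these makes the two lifts coprime.
  obtain ⟨k, hk0, hk1, hk⟩ := exists_avoiding (w i).val
    (fun p k => (p : ℤ) ∣ (w j).val + q * k) (by
      intro p hp k k' h h'
      have h1 : (p : ℤ) ∣ q * (k - k') := by
        have := dvd_sub h h'
        rwa [add_sub_add_left_eq_sub, ← mul_sub] at this
      have hpp := Nat.prime_of_mem_primeFactors hp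
      refine ((Nat.prime_iff_prime_int.1 hpp).dvd_or_dvd h1).resolve_left fun h2 => ?_
      have h3 := Nat.dvd_gcd (Nat.dvd_of_mem_primeFactors hp) (Int.natCast_dvd_natCast.1 h2)
      rw [hcop.gcd_eq_one] at h3
      exact hpp.one_lt.ne' (Nat.dvd_one.1 h3))
  let v : Fin n → ℤ := fun l => if l = j then (w j).val + q * k else (w l).val
  have hvj : v j = (w j).val + q * k := if_pos rfl
  have hvl : ∀ l, l ≠ j → v l = (w l).val := fun l hl => if_neg hl
  have hvw : ∀ l, ((v l : ℤ) : ZMod q) = w l := by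
    intro l
    by_cases hl : l = j
    · rw [hl, hvj]
      simp
    · rw [hvl l hl]
      simp
  have hvcop : IsCoprime (v i) (v j) := by
    rw [hvl i hij, hvj, Int.isCoprime_iff_gcd_eq_one]
    refine Nat.coprime_of_dvd fun p hp h1 h2 => ?_
    exact hk p (Nat.mem_primeFactors.2 ⟨hp, by rwa [Int.natAbs_natCast] at h1, hwi0⟩) (Int.natCast_dvd.2 h2)
  obtain ⟨b, d, hbd, hb, hd⟩ := exists_bezout_le hvcop
  have hq2 : (2 : ℝ) ≤ q := by exact_mod_cast hq
  have hWi : (2 : ℝ) ^ (w i).val.primeFactors.card ≤ W :=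
    hW _ hwi0 ((ZMod.val_lt (w i)).le.trans (Nat.le_self_pow (by norm_num) q))
  have hW1 : 1 ≤ W := le_trans (one_le_pow₀ (by norm_num)) hWi
  have hqW : (q : ℝ) ≤ q * W := le_mul_of_one_le_right (by positivity) hW1
  have hval : ∀ l, |(((w l).val : ℤ) : ℝ)| ≤ q := fun l => by
    rw [Int.cast_natCast, Nat.abs_cast]
    exact_mod_cast (ZMod.val_lt (w l)).le
  have hvjb : |(v j : ℝ)| ≤ q + q * W := by
    rw [hvj]
    push_cast
    refine (abs_add_le _ _).trans (add_le_add (by simpa using hval j) ?_)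
    rw [abs_mul, Nat.abs_cast]
    refine mul_le_mul_of_nonneg_left ?_ (by positivity)
    rw [abs_of_nonneg (by exact_mod_cast hk0)]
    exact le_trans (by exact_mod_cast hk1) hWi
  have hvib : |(v i : ℝ)| ≤ q := by
    rw [hvl i hij]
    exact hval i
  have hsum : |(v i : ℝ)| + |(v j : ℝ)| + 1 ≤ 4 * q * W := by linarith
  refine ⟨cornerCol hij v b d hbd, Subtype.ext (funext fun l => ?_),
    slNorm_le_of_entries _ (by positivity)
      (abs_cornerCol_le hij hbd (by linarith) (fun l => ?_) ?_ ?_)⟩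
  · rw [cornerCol_smul hij hbd x hxj, hvw, ← ha]
    simp only [w]
    rw [mul_comm, ← mul_assoc, Units.mul_inv, one_mul, sub_add_cancel]
  · by_cases hl : l = j
    · rw [hl]
      linarith
    · rw [hvl l hl]
      linarith [hval l]
  · exact le_trans (by exact_mod_cast hb) hsum
  · exact le_trans (by exact_mod_cast hd) hsum

/-- A short primitive relation between the coordinates of `x` gives a short matrix that makes a
coordinate of `x` vanish. -/
theorem exists_smul_apply_eq_zero {n q : ℕ} (hn : 2 ≤ n) (x : PrimVec n q) {r : Fin n → ℤ}
    (hr : ∀ p : ℕ, p.Prime → ∃ l, ¬ (p : ℤ) ∣ r l) (hrx : ∑ l, (r l : ZMod q) * x.1 l = 0)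
    {R : ℕ} (hR : ∀ l, |r l| ≤ R) (hRq : R ≤ q ^ 3) {W : ℝ}
    (hW : ∀ m : ℕ, m ≠ 0 → m ≤ q ^ 3 → (2 : ℝ) ^ m.primeFactors.card ≤ W) :
    ∃ (γ : SL(n, ℤ)) (i j : Fin n), i ≠ j ∧ (γ • x).1 j = 0 ∧
      slNorm γ ≤ 3 * n ^ 3 * W ^ 2 * R := by
  obtain ⟨l₀, hl₀⟩ := hr 2 Nat.prime_two
  have hj : ∃ j, r j ≠ 0 := ⟨l₀, fun h => hl₀ (h ▸ dvd_zero _)⟩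
  obtain ⟨j, hj⟩ := hj
  have : Nontrivial (Fin n) := Fin.nontrivial_iff_two_le.2 hn
  obtain ⟨i, hij⟩ := exists_ne j
  obtain ⟨k, hki, hk, hkp⟩ := exists_small_combination (r j).natAbs r i
  have hj0 : (r j).natAbs ≠ 0 := Int.natAbs_ne_zero.2 hj
  have hjR : (r j).natAbs ≤ R := by
    have := hR j
    rw [Int.abs_eq_natAbs] at this
    exact_mod_cast this
  have hR1 : (1 : ℝ) ≤ R := by exact_mod_cast (Nat.one_le_iff_ne_zero.2 hj0).trans hjR
  have hWj := hW _ hj0 (hjR.trans hRq)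
  have hW1 : 1 ≤ W := le_trans (one_le_pow₀ (by norm_num)) hWj
  have hkW : ∀ l, |(k l : ℝ)| ≤ W := fun l => le_trans (by exact_mod_cast hk l) hWj
  have hRR : ∀ l, |(r l : ℝ)| ≤ R := fun l => by exact_mod_cast hR l
  let k' : Fin n → ℤ := fun l => if l = i then 1 else -k l
  have hk'i : k' i = 1 := if_pos rfl
  have hk'W : ∀ l, |(k' l : ℝ)| ≤ W := by
    intro l
    by_cases hl : l = i
    · rw [hl, hk'i]
      simpa using hW1
    · have : k' l = -k l := if_neg hl
      rw [this, Int.cast_neg, abs_neg]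
      exact hkW l
  -- Subtracting `k l * x i` from each `x l`, `l ≠ i`, turns the relation `r` into `r'`, whose entry
  -- at `i` is `s`. By choice of `k`, `s` is coprime to `r j`, so `r'` can be completed as row `j`
  -- of a matrix of determinant `1`.
  let s : ℤ := ∑ l, k l * r l
  let r' : Fin n → ℤ := fun l => if l = i then s else r l
  have hr'i : r' i = s := if_pos rfl
  have hr'l : ∀ l, l ≠ i → r' l = r l := fun l hl => if_neg hl
  have hcop : IsCoprime (r' j) (r' i) := by
    rw [hr'i, hr'l j hij.symm, Int.isCoprime_iff_gcd_eq_one]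
    refine Nat.coprime_of_dvd fun p hp h1 h2 => ?_
    exact hkp p (Nat.mem_primeFactors.2 ⟨hp, h1, hj0⟩) (hr p hp) (Int.natCast_dvd.2 h2)
  obtain ⟨b, d, hbd, hb, hd⟩ := exists_bezout_le hcop
  have hsb : |(s : ℝ)| ≤ n * (W * R) := by
    simp only [s]
    push_cast
    refine (Finset.abs_sum_le_sum_abs _ _).trans ?_
    calc ∑ l, |(k l : ℝ) * (r l : ℝ)| ≤ ∑ _l : Fin n, W * R :=
          Finset.sum_le_sum fun l _ => by
            rw [abs_mul]
            exact mul_le_mul (hkW l) (hRR l) (abs_nonneg _) (by positivity)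
      _ = _ := by simp
  have hn1 : (1 : ℝ) ≤ n := by exact_mod_cast (by omega : 1 ≤ n)
  have hWR : (R : ℝ) ≤ W * R := le_mul_of_one_le_left (by positivity) hW1
  have hnWR : W * R ≤ n * (W * R) := le_mul_of_one_le_left (by positivity) hn1
  have hsum : |(r' j : ℝ)| + |(r' i : ℝ)| + 1 ≤ 3 * (n * (W * R)) := by
    rw [hr'i, hr'l j hij.symm]
    linarith [hRR j]
  refine ⟨(cornerCol hij.symm r' b d hbd).transpose * colOp i k' hk'i, i, j, hij, ?_, ?_⟩
  · rw [mul_smul, cornerRow_smul, ← hrx, ← Finset.add_sum_erase _ _ (Finset.mem_univ i), hr'i,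
      colOp_smul, hk'i, if_pos rfl]
    simp only [s]
    push_cast
    rw [add_zero, one_mul, Finset.sum_mul, ← Finset.add_sum_erase _ _ (Finset.mem_univ i),
      ← Finset.add_sum_erase _ (fun l => (r l : ZMod q) * x.1 l) (Finset.mem_univ i), add_assoc,
      ← Finset.sum_add_distrib, hki]
    congr 1
    · simp
    · refine Finset.sum_congr rfl fun l hl => ?_
      have hl := Finset.ne_of_mem_erase hl
      have : k' l = -k l := if_neg hl
      rw [colOp_smul, this, if_neg hl, hr'l l hl]
      push_cast
      ring
  · refine (slNorm_mul_le _ _).trans ?_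
    calc _ ≤ (n * (3 * (n * (W * R)))) * (n * W) := by
          refine mul_le_mul ?_ (slNorm_le_of_entries _ (by positivity) (abs_colOp_le hk'i hk'W))
            (slNorm_nonneg _) (by positivity)
          refine slNorm_le_of_entries _ (by positivity) fun l m =>
            abs_cornerCol_le hij.symm hbd (by linarith) (fun l => ?_) ?_ ?_ m l
          · by_cases hl : l = i
            · rw [hl, hr'i]
              linarith
            · rw [hr'l l hl]
              linarith [hRR l]
          · exact le_trans (by exact_mod_cast hb) hsum
          · exact le_trans (by exact_mod_cast hd) hsum
      _ = _ := by ring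

/-- Only `τ`, of size `R`, and `γ`, of size `q`, are expensive. Making coordinate `i` a unit leaves
the zero at `j` untouched. -/
theorem exists_smul_eq_of_relation {n q : ℕ} (hn : 2 ≤ n) (hq : 2 ≤ q) (x y : PrimVec n q)
    {r : Fin n → ℤ} (hr : ∀ p : ℕ, p.Prime → ∃ l, ¬ (p : ℤ) ∣ r l)
    (hrx : ∑ l, (r l : ZMod q) * x.1 l = 0) {R : ℕ} (hR : ∀ l, |r l| ≤ R) (hRq : R ≤ q ^ 3)
    {W : ℝ} (hW : ∀ m : ℕ, m ≠ 0 → m ≤ q ^ 3 → (2 : ℝ) ^ m.primeFactors.card ≤ W) :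
    ∃ γ : SL(n, ℤ), γ • x = y ∧ slNorm γ ≤ 12 * n ^ 6 * W ^ 5 * R * q := by
  have hq0 : q ≠ 0 := by omega
  have hWq := hW q hq0 (Nat.le_self_pow (by norm_num) q)
  have hW1 : 1 ≤ W := le_trans (one_le_pow₀ (by norm_num)) hWq
  obtain ⟨τ, i, j, hij, hτj, hτ⟩ := exists_smul_apply_eq_zero hn x hr hrx hR hRq hW
  obtain ⟨α, -, -, hαu, hαj, hα, -⟩ := exists_smul_isUnit hq0 (τ • x) i
  obtain ⟨β, β', hβ, hβu, -, -, hβ'⟩ := exists_smul_isUnit hq0 y i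
  obtain ⟨γ, h, hγ⟩ := exists_smul_eq_of_apply_eq_zero hq hij
    ((hαj j hij.symm).trans hτj) hαu hβu hW
  refine ⟨β' * (γ * (α * τ)), ?_, ?_⟩
  · rw [mul_smul, mul_smul, mul_smul, h, hβ]
  · have hnW : (n : ℝ) * 2 ^ q.primeFactors.card ≤ n * W := by gcongr
    have h1 : slNorm (α * τ) ≤ (n * W) * (3 * n ^ 3 * W ^ 2 * R) :=
      (slNorm_mul_le _ _).trans
        (mul_le_mul (hα.trans hnW) hτ (slNorm_nonneg _) (by positivity))
    have h2 : slNorm (γ * (α * τ)) ≤ (n * (4 * q * W)) * ((n * W) * (3 * n ^ 3 * W ^ 2 * R)) :=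
      (slNorm_mul_le _ _).trans (mul_le_mul hγ h1 (slNorm_nonneg _) (by positivity))
    calc _ ≤ (n * W) * ((n * (4 * q * W)) * ((n * W) * (3 * n ^ 3 * W ^ 2 * R))) :=
          (slNorm_mul_le _ _).trans
            (mul_le_mul (hβ'.trans hnW) h2 (slNorm_nonneg _) (by positivity))
      _ = _ := by ring

/-! ### Short relations modulo `q` -/

/-- Pigeonhole: a short relation modulo `q` between the `a l` with `l ∈ J`. -/
theorem exists_short_relation {n q : ℕ} (hq : q ≠ 0) (a : Fin n → ℤ) (J : Finset (Fin n)) {K : ℕ}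
    (hK : q < (K + 1) ^ J.card) :
    ∃ s : Fin n → ℤ, s ≠ 0 ∧ (∀ l, |s l| ≤ K) ∧ (∀ l ∉ J, s l = 0) ∧
      (q : ℤ) ∣ ∑ l, s l * a l := by
  classical
  have : NeZero q := ⟨hq⟩
  let ext : (J → Fin (K + 1)) → Fin n → ℤ := fun f l => if h : l ∈ J then (f ⟨l, h⟩ : ℕ) else 0
  have hext : ∀ f l, 0 ≤ ext f l ∧ ext f l ≤ K := by
    intro f l
    by_cases h : l ∈ J
    · have h1 : ext f l = (f ⟨l, h⟩ : ℕ) := dif_pos h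
      have h2 := (f ⟨l, h⟩).2
      omega
    · have h1 : ext f l = 0 := dif_neg h
      omega
  -- Two points of the box `[0, K] ^ J` collide modulo `q`; their difference is the relation.
  obtain ⟨f, g, hfg, he⟩ := Fintype.exists_ne_map_eq_of_card_lt
    (fun f : J → Fin (K + 1) => ((∑ l, ext f l * a l : ℤ) : ZMod q)) (by simpa using hK)
  refine ⟨fun l => ext f l - ext g l, fun h => hfg (funext fun l => ?_), fun l => ?_,
    fun l hl => ?_, ?_⟩
  · have h1 : ext f l = ext g l := sub_eq_zero.1 (congrFun h l)
    simp only [ext, l.2, dif_pos] at h1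
    exact Fin.ext (by exact_mod_cast h1)
  · have h1 := hext f l
    have h2 := hext g l
    exact abs_le.2 ⟨by linarith [h1.1, h2.2], by linarith [h1.2, h2.1]⟩
  · simp [ext, hl]
  · rw [← ZMod.intCast_zmod_eq_zero_iff_dvd]
    simp only [sub_mul, Finset.sum_sub_distrib]
    rw [Int.cast_sub, sub_eq_zero]
    exact he

/-- The gcd of the entries is at most `K < q`, hence invertible modulo the prime `q` and can be
divided out. For composite `q` this may destroy the relation. -/
theorem exists_short_primitive_relation_of_prime {n q : ℕ} (hq : q.Prime) (a : Fin n → ℤ)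
    {K : ℕ} (hK : q < (K + 1) ^ n) (hKq : K < q) :
    ∃ r : Fin n → ℤ, (∀ p : ℕ, p.Prime → ∃ l, ¬ (p : ℤ) ∣ r l) ∧ (∀ l, |r l| ≤ K) ∧
      (q : ℤ) ∣ ∑ l, r l * a l := by
  obtain ⟨s, hs0, hsK, -, hsa⟩ := exists_short_relation hq.ne_zero a Finset.univ
    (by simpa using hK)
  obtain ⟨l₀, hl₀⟩ := Function.ne_iff.1 hs0
  obtain ⟨r, hr, hr1⟩ := Finset.extract_gcd s ⟨l₀, Finset.mem_univ _⟩
  have hr : ∀ l, s l = Finset.univ.gcd s * r l := fun l => hr l (Finset.mem_univ l)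
  set g := Finset.univ.gcd s
  have hg0 : g ≠ 0 := fun h => hl₀ (by rw [hr, h, zero_mul, Pi.zero_apply])
  have hg1 : 1 ≤ |g| := Int.one_le_abs hg0
  have hgq : ¬ (q : ℤ) ∣ g := by
    intro h
    have h1 := Int.le_of_dvd (abs_pos.2 hl₀) ((dvd_abs _ _).2 (h.trans ⟨_, hr l₀⟩))
    have h2 := hsK l₀
    omega
  refine ⟨r, fun p hp => ?_, fun l => ?_, ?_⟩
  · by_contra! h
    have h1 : (p : ℤ) ∣ 1 := hr1 ▸ Finset.dvd_gcd fun l _ => h l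
    exact (Nat.prime_iff_prime_int.1 hp).not_dvd_one h1
  · refine le_trans ?_ (hsK l)
    rw [hr l, abs_mul]
    exact le_mul_of_one_le_left (abs_nonneg _) hg1
  · have h1 : ∑ l, s l * a l = g * ∑ l, r l * a l := by
      rw [Finset.mul_sum]
      exact Finset.sum_congr rfl fun l _ => by rw [hr l, mul_assoc]
    rw [h1] at hsa
    exact ((Nat.prime_iff_prime_int.1 hq).dvd_or_dvd hsa).resolve_left hgq

/-- Two independent vectors of norm at most `K` in a subgroup of `ℤⁿ` may be replaced by two such
vectors that span a saturated sublattice. -/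
theorem exists_saturated_pair {n : ℕ} (M : AddSubgroup (Fin n → ℤ)) (i j : Fin n) {K : ℕ}
    {u v : Fin n → ℤ} (hu : u ∈ M) (hv : v ∈ M) (huK : ∀ l, |u l| ≤ K) (hvK : ∀ l, |v l| ≤ K)
    (h : u i * v j - u j * v i ≠ 0) :
    ∃ u ∈ M, ∃ v ∈ M, (∀ l, |u l| ≤ K) ∧ (∀ l, |v l| ≤ K) ∧
      ∀ p : ℕ, p.Prime → ∀ α β : ℤ, ∀ z ∈ M, (p : ℤ) • z = α • u + β • v →
        (p : ℤ) ∣ α ∧ (p : ℤ) ∣ β := by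
  -- Descent on a nonzero minor, which also certifies independence.
  induction hD : (u i * v j - u j * v i).natAbs using Nat.strong_induction_on
    generalizing u v with
  | _ D ih =>
    subst hD
    by_cases hsat : ∀ p : ℕ, p.Prime → ∀ α β : ℤ, ∀ z ∈ M, (p : ℤ) • z = α • u + β • v →
        (p : ℤ) ∣ α ∧ (p : ℤ) ∣ β
    · exact ⟨u, hu, v, hv, huK, hvK, hsat⟩
    push Not at hsat
    obtain ⟨p, hp, α, β, z, hz, hzp, hαβ⟩ := hsat
    have hp0 : (0 : ℤ) < p := by exact_mod_cast hp.pos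
    -- With balanced residues, `|α'| + |β'| ≤ p`, so `w = (α' u + β' v) / p` stays in the box of
    -- size `K`.
    have key : ∃ α' β' : ℤ, ∃ w ∈ M, (p : ℤ) • w = α' • u + β' • v ∧ 2 * |α'| ≤ p ∧
        2 * |β'| ≤ p ∧ (α' ≠ 0 ∨ β' ≠ 0) := by
      refine ⟨α.bmod p, β.bmod p, z - (α.bdiv p) • u - (β.bdiv p) • v,
        M.sub_mem (M.sub_mem hz (M.zsmul_mem hu _)) (M.zsmul_mem hv _), ?_, ?_, ?_, ?_⟩
      · rw [smul_sub, smul_sub, hzp, smul_smul, smul_smul]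
        have h1 := Int.bmod_add_bdiv α p
        have h2 := Int.bmod_add_bdiv β p
        nth_rewrite 1 [← h1, ← h2]
        rw [add_smul, add_smul]
        abel
      · have h1 := Int.bmod_le (x := α) hp.pos
        have h2 := Int.le_bmod (x := α) hp.pos
        rcases abs_cases (α.bmod p) with h3 | h3 <;> omega
      · have h1 := Int.bmod_le (x := β) hp.pos
        have h2 := Int.le_bmod (x := β) hp.pos
        rcases abs_cases (β.bmod p) with h3 | h3 <;> omega
      · by_contra! h0
        exact hαβ (Int.dvd_of_bmod_eq_zero h0.1) (Int.dvd_of_bmod_eq_zero h0.2)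
    obtain ⟨α', β', w, hw, hwp, hα, hβ, hne⟩ := key
    have hwl : ∀ l, (p : ℤ) * w l = α' * u l + β' * v l := fun l => by
      simpa using congrFun hwp l
    have hwK : ∀ l, |w l| ≤ K := by
      intro l
      have h1 : (p : ℤ) * |w l| ≤ |α'| * K + |β'| * K := by
        calc (p : ℤ) * |w l| = |α' * u l + β' * v l| := by
              rw [← hwl, abs_mul, abs_of_pos hp0]
          _ ≤ |α'| * |u l| + |β'| * |v l| := by
              rw [← abs_mul, ← abs_mul]
              exact abs_add_le _ _
          _ ≤ _ := add_le_add (mul_le_mul_of_nonneg_left (huK l) (abs_nonneg _))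
              (mul_le_mul_of_nonneg_left (hvK l) (abs_nonneg _))
      have h2 : (|α'| + |β'|) * (K : ℤ) ≤ p * K :=
        mul_le_mul_of_nonneg_right (by omega) (by positivity)
      rw [add_mul] at h2
      exact le_of_mul_le_mul_left (h1.trans h2) hp0
    -- Replacing `u` or `v` by `w` multiplies the minor by `c / p`, of absolute value at most `1/2`.
    have descent : ∀ c D' : ℤ, c ≠ 0 → 2 * |c| ≤ p →
        (p : ℤ) * D' = c * (u i * v j - u j * v i) →
        D' ≠ 0 ∧ D'.natAbs < (u i * v j - u j * v i).natAbs := by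
      intro c D' hc hcp hD'
      refine ⟨fun h0 => ?_, ?_⟩
      · rw [h0, mul_zero] at hD'
        exact mul_ne_zero hc h hD'.symm
      · have h1 : (p : ℤ) * |D'| = |c| * |u i * v j - u j * v i| := by
          rw [← abs_mul, ← hD', abs_mul, abs_of_pos hp0]
        have h2 : 0 < |u i * v j - u j * v i| := abs_pos.2 h
        have h3 : |c| < p := by omega
        have h4 : (p : ℤ) * |D'| < p * |u i * v j - u j * v i| := by
          rw [h1]
          exact mul_lt_mul_of_pos_right h3 h2
        have h5 := lt_of_mul_lt_mul_left h4 hp0.le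
        rw [Int.abs_eq_natAbs, Int.abs_eq_natAbs] at h5
        exact_mod_cast h5
    by_cases hβ0 : β' = 0
    · have hα0 : α' ≠ 0 := hne.resolve_right (fun h => h hβ0)
      obtain ⟨h1, h2⟩ := descent α' (w i * v j - w j * v i) hα0 hα (by
        linear_combination v j * hwl i - v i * hwl j)
      exact ih _ h2 hw hv hwK hvK h1 rfl
    · obtain ⟨h1, h2⟩ := descent β' (u i * w j - u j * w i) hβ0 hβ (by
        linear_combination u i * hwl j - u j * hwl i)
      exact ih _ h2 hu hw huK hwK h1 rfl

theorem exists_short_primitive_relation {n q : ℕ} (hn : 2 ≤ n) (hq : q ≠ 0) (a : Fin n → ℤ)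
    {K : ℕ} (hK : q < (K + 1) ^ (n - 1)) :
    ∃ r : Fin n → ℤ, (∀ p : ℕ, p.Prime → ∃ l, ¬ (p : ℤ) ∣ r l) ∧
      (∀ l, |r l| ≤ (2 ^ q.primeFactors.card + 1 : ℕ) * (K : ℤ)) ∧
      (q : ℤ) ∣ ∑ l, r l * a l := by
  let M : AddSubgroup (Fin n → ℤ) :=
    { carrier := {s | (q : ℤ) ∣ ∑ l, s l * a l}
      zero_mem' := by simp
      add_mem' := fun {s t} hs ht => by
        simp only [Set.mem_ofPred_eq, Pi.add_apply, add_mul, Finset.sum_add_distrib] at *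
        exact dvd_add hs ht
      neg_mem' := fun {s} hs => by
        simp only [Set.mem_ofPred_eq, Pi.neg_apply, neg_mul, Finset.sum_neg_distrib] at *
        exact (dvd_neg).2 hs }
  have hM : ∀ s, s ∈ M ↔ (q : ℤ) ∣ ∑ l, s l * a l := fun s => Iff.rfl
  have hcard : ∀ i : Fin n, q < (K + 1) ^ (Finset.univ.erase i).card := fun i => by
    rwa [Finset.card_erase_of_mem (Finset.mem_univ i), Finset.card_univ, Fintype.card_fin]
  obtain ⟨u, hu0, huK, -, hu⟩ := exists_short_relation hq a _ (hcard ⟨0, by omega⟩)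
  obtain ⟨i, hi⟩ := Function.ne_iff.1 hu0
  -- Omitting coordinate `i`, where `u i ≠ 0`, makes `v` independent of `u`. This is what costs the
  -- exponent `1/(n-1)` instead of `1/n`.
  obtain ⟨v, hv0, hvK, hvi, hv⟩ := exists_short_relation hq a _ (hcard i)
  obtain ⟨j, hj⟩ := Function.ne_iff.1 hv0
  have hvi : v i = 0 := hvi i (Finset.notMem_erase _ _)
  obtain ⟨u, hu, v, hv, huK, hvK, hsat⟩ := exists_saturated_pair M i j hu hv huK hvK (by
    rw [hvi, mul_zero, sub_zero]
    exact mul_ne_zero hi hj)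
  have hndvd : ∀ p ∈ q.primeFactors, (∃ l, ¬ (p : ℤ) ∣ u l) ∨ ∃ l, ¬ (p : ℤ) ∣ v l := by
    intro p hp
    by_contra! h
    have hpp := Nat.prime_of_mem_primeFactors hp
    have hp0 : (p : ℤ) ≠ 0 := by exact_mod_cast hpp.ne_zero
    obtain ⟨q', hq'⟩ := Nat.dvd_of_mem_primeFactors hp
    choose u' hu' using h.1
    choose v' hv' using h.2
    have hpu : (p : ℤ) • u' = u := funext fun l => by simp [hu' l]
    have hpv : (p : ℤ) • v' = v := funext fun l => by simp [hv' l]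
    have hscale : ∀ s : Fin n → ℤ, (p : ℤ) • s ∈ M → (q' : ℤ) ∣ ∑ l, s l * a l := by
      intro s hs
      rw [hM, hq'] at hs
      simp only [Pi.smul_apply, smul_eq_mul, mul_assoc, ← Finset.mul_sum] at hs
      push_cast at hs
      exact (mul_dvd_mul_iff_left hp0).1 hs
    obtain ⟨c, hc⟩ := hscale u' (hpu ▸ hu)
    obtain ⟨d, hd⟩ := hscale v' (hpv ▸ hv)
    -- This combination pairs to `0` with `a`, and `p` times it is `d • u - c • v`. Saturation gives
    -- `p ∣ c`, so `u' = u / p` lies in `M`, contradicting saturation again.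
    have hz : d • u' - c • v' ∈ M := by
      rw [hM]
      simp only [Pi.sub_apply, Pi.smul_apply, smul_eq_mul, sub_mul, mul_assoc,
        Finset.sum_sub_distrib, ← Finset.mul_sum]
      rw [hc, hd]
      exact ⟨0, by ring⟩
    obtain ⟨-, hpc⟩ := hsat p hpp d (-c) _ hz (by
      rw [← hpu, ← hpv, smul_sub, smul_comm d, smul_comm (-c), neg_smul, smul_neg, sub_eq_add_neg])
    have hu'M : u' ∈ M := by
      rw [hM, hc, hq', mul_comm p q']
      push_cast
      exact mul_dvd_mul_left _ ((dvd_neg).1 hpc)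
    obtain ⟨hp1, -⟩ := hsat p hpp 1 0 u' hu'M (by rw [hpu, one_smul, zero_smul, add_zero])
    exact (Nat.prime_iff_prime_int.1 hpp).not_dvd_one hp1
  -- Only primes dividing `q` need a choice of `k`: for the others, `v + k • u = p • s` puts `s` in
  -- `M`, against saturation.
  obtain ⟨k, hk0, hk1, hk⟩ := exists_avoiding q (fun p k => ∀ l, (p : ℤ) ∣ v l + k * u l) (by
    intro p hp k k' h h'
    have h1 : ∀ l, (p : ℤ) ∣ (k - k') * u l := fun l => by
      have := dvd_sub (h l) (h' l)
      rwa [add_sub_add_left_eq_sub, ← sub_mul] at this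
    have hpp := Nat.prime_iff_prime_int.1 (Nat.prime_of_mem_primeFactors hp)
    by_contra hkk
    have h2 : ∀ l, (p : ℤ) ∣ u l := fun l => (hpp.dvd_or_dvd (h1 l)).resolve_left hkk
    rcases hndvd p hp with ⟨l, hl⟩ | ⟨l, hl⟩
    · exact hl (h2 l)
    · exact hl ((dvd_add_left (dvd_mul_of_dvd_right (h2 l) k)).1 (h l)))
  have hrM : v + k • u ∈ M := M.add_mem hv (M.zsmul_mem hu k)
  refine ⟨v + k • u, fun p hp => ?_, fun l => ?_, hrM⟩
  · by_cases hpq : p ∈ q.primeFactors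
    · have := hk p hpq
      push Not at this
      simpa using this
    · by_contra! h
      choose s hs using h
      have hps : (p : ℤ) • s = v + k • u := funext fun l => by rw [hs l]; simp
      have hsM : s ∈ M := by
        rw [hM]
        have h1 : (q : ℤ) ∣ p * ∑ l, s l * a l := by
          rw [← hps, hM] at hrM
          simpa only [Pi.smul_apply, smul_eq_mul, mul_assoc, ← Finset.mul_sum] using hrM
        refine IsCoprime.dvd_of_dvd_mul_left ?_ h1
        rw [Nat.isCoprime_iff_coprime, Nat.coprime_comm, hp.coprime_iff_not_dvd]
        exact fun h => hpq (Nat.mem_primeFactors.2 ⟨hp, h, hq⟩)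
      obtain ⟨-, hp1⟩ := hsat p hp k 1 s hsM (by rw [hps, one_smul, add_comm])
      exact (Nat.prime_iff_prime_int.1 hp).not_dvd_one hp1
  · simp only [Pi.add_apply, Pi.smul_apply, smul_eq_mul]
    refine (abs_add_le _ _).trans ?_
    rw [abs_mul, abs_of_nonneg hk0]
    have h1 : k * |u l| ≤ 2 ^ q.primeFactors.card * K :=
      mul_le_mul hk1 (huK l) (abs_nonneg _) (by positivity)
    have h2 := hvK l
    push_cast
    linarith

/-! ### Bounds for the normalized diameter -/

theorem diamExp_le {n q : ℕ} {X : Type} [MulAction SL(n, ℤ) X] (hq : 2 ≤ q) {c : ℝ} (hc : 0 ≤ c)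
    (h : ∀ x y : X, ∃ γ : SL(n, ℤ), γ • x = y ∧ slNorm γ ≤ (q : ℝ) ^ c) :
    diamExp n X q ≤ (c : EReal) := by
  have hq1 : (1 : ℝ) < q := by exact_mod_cast hq
  have hlog : 0 < Real.log q := Real.log_pos hq1
  refine iSup_le fun x => iSup_le fun y => ?_
  rw [EReal.div_le_iff_le_mul (by exact_mod_cast hlog) (EReal.coe_ne_top _), ← EReal.coe_mul]
  obtain ⟨γ, hγ, hle⟩ := h x y
  refine (iInf₂_le γ hγ).trans (EReal.coe_le_coe_iff.2 ?_)
  -- Norm `0` occurs for `n = 0`; there `Real.log 0 = 0` and `0 ≤ c` suffice.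
  rcases (slNorm_nonneg γ).eq_or_lt with h0 | h0
  · rw [← h0, Real.log_zero]
    positivity
  · calc Real.log (slNorm γ) ≤ Real.log ((q : ℝ) ^ c) := Real.log_le_log h0 hle
      _ = Real.log q * c := by rw [Real.log_rpow (by positivity), mul_comm]

theorem le_diamExp {n q : ℕ} {X : Type} [MulAction SL(n, ℤ) X] (hq : 2 ≤ q) {c : ℝ} (x y : X)
    (h : ∀ γ : SL(n, ℤ), γ • x = y → (q : ℝ) ^ c ≤ slNorm γ) :
    (c : EReal) ≤ diamExp n X q := by
  have hq1 : (1 : ℝ) < q := by exact_mod_cast hq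
  have hlog : 0 < Real.log q := Real.log_pos hq1
  refine le_iSup₂_of_le x y ?_
  rw [EReal.le_div_iff_mul_le (by exact_mod_cast hlog) (EReal.coe_ne_top _), ← EReal.coe_mul]
  refine le_iInf₂ fun γ hγ => EReal.coe_le_coe_iff.2 ?_
  rw [← Real.log_rpow (by positivity)]
  exact Real.log_le_log (by positivity) (h γ hγ)

theorem eventually_const_mul_rpow_le (C : ℝ) {c c' : ℝ} (h : c < c') :
    ∀ᶠ q : ℕ in Filter.atTop, C * (q : ℝ) ^ c ≤ (q : ℝ) ^ c' := by
  have h1 := ((tendsto_rpow_atTop (sub_pos.2 h)).comp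
    tendsto_natCast_atTop_atTop).eventually_ge_atTop C
  filter_upwards [h1, Filter.eventually_gt_atTop 0] with q hq hq0
  have hq0 : (0 : ℝ) < q := by exact_mod_cast hq0
  calc C * (q : ℝ) ^ c ≤ (q : ℝ) ^ (c' - c) * (q : ℝ) ^ c :=
        mul_le_mul_of_nonneg_right hq (by positivity)
    _ = (q : ℝ) ^ c' := by rw [← Real.rpow_add hq0, sub_add_cancel]

/-! ### Upper bounds -/

theorem eventually_diamExp_projSpace_le {n : ℕ} (hn : 0 < n) {z : ℝ} (hz : 1 < z) :
    ∀ᶠ q : ℕ in Filter.atTop, diamExp n (ProjSpace n q) q ≤ (z : EReal) := by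
  -- Two factors `2 ^ ω(q)` cost `q ^ ((z - 1) / 2)`, for a total exponent `(z + 1) / 2 < z`.
  obtain ⟨C, hC1, hC⟩ := exists_two_pow_card_primeFactors_le (ε := (z - 1) / 4) (by linarith)
  filter_upwards [eventually_const_mul_rpow_le (n ^ 3 * C ^ 2) (c := (z + 1) / 2) (c' := z)
    (by linarith), Filter.eventually_ge_atTop 2] with q hqC hq
  have hq0 : q ≠ 0 := by omega
  have hqr : (0 : ℝ) < q := by exact_mod_cast Nat.pos_of_ne_zero hq0
  refine diamExp_le hq (by linarith) fun x y => ?_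
  induction x using Quotient.inductionOn with | _ x
  induction y using Quotient.inductionOn with | _ y
  obtain ⟨γ, u, h, hγ⟩ := exists_smul_eq_units_smul hn hq0 x y
  refine ⟨γ, Quotient.sound ⟨u, h.symm⟩, hγ.trans (le_trans ?_ hqC)⟩
  calc (n : ℝ) ^ 3 * (2 ^ q.primeFactors.card) ^ 2 * q
      ≤ n ^ 3 * (C * (q : ℝ) ^ ((z - 1) / 4)) ^ 2 * q := by
        gcongr
        exact hC q hq0
    _ = n ^ 3 * C ^ 2 * (((q : ℝ) ^ ((z - 1) / 4)) ^ 2 * (q : ℝ) ^ (1 : ℝ)) := by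
        rw [Real.rpow_one]
        ring
    _ = _ := by
        rw [← Real.rpow_mul_natCast hqr.le, ← Real.rpow_add hqr]
        congr 2
        push_cast
        ring

/-- Short primitive relations modulo `q` bound the diameter of the space of primitive vectors. -/
theorem eventually_diamExp_primVec_le {n : ℕ} (hn : 2 ≤ n) {s z : ℝ} (hs : 0 ≤ s)
    (hz : 1 + s < z) :
    ∀ᶠ q : ℕ in Filter.atTop, (∀ a : Fin n → ℤ, ∃ (r : Fin n → ℤ) (R : ℕ),
      (∀ p : ℕ, p.Prime → ∃ l, ¬ (p : ℤ) ∣ r l) ∧ (q : ℤ) ∣ ∑ l, r l * a l ∧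
      (∀ l, |r l| ≤ R) ∧ R ≤ q ^ 3 ∧ (R : ℝ) ≤ 2 * 2 ^ q.primeFactors.card * (q : ℝ) ^ s) →
      diamExp n (PrimVec n q) q ≤ (z : EReal) := by
  -- Six factors `W = C * q ^ (3 * δ)` occur, one of them from `R`; `18 * δ` is half of the
  -- available gap.
  set δ := (z - (1 + s)) / 36 with hδ
  have hδ0 : 0 < δ := by
    rw [hδ]
    linarith
  obtain ⟨C, hC1, hC⟩ := exists_two_pow_card_primeFactors_le hδ0
  filter_upwards [eventually_const_mul_rpow_le (24 * n ^ 6 * C ^ 6) (c := 18 * δ + s + 1)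
    (c' := z) (by rw [hδ]; linarith), Filter.eventually_ge_atTop 2] with q hqC hq hrel
  have hq0 : q ≠ 0 := by omega
  have : NeZero q := ⟨hq0⟩
  have hqr : (0 : ℝ) < q := by exact_mod_cast Nat.pos_of_ne_zero hq0
  refine diamExp_le hq (by linarith) fun x y => ?_
  obtain ⟨r, R, hr, hrx, hR, hRq, hRs⟩ := hrel fun l => ((x.1 l).val : ℤ)
  have hrx' : ∑ l, (r l : ZMod q) * x.1 l = 0 := by
    have := (ZMod.intCast_zmod_eq_zero_iff_dvd _ _).2 hrx
    push_cast at this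
    simpa using this
  have hW : ∀ m : ℕ, m ≠ 0 → m ≤ q ^ 3 →
      (2 : ℝ) ^ m.primeFactors.card ≤ C * ((q : ℝ) ^ δ) ^ 3 := by
    intro m hm hmq
    refine (hC m hm).trans (mul_le_mul_of_nonneg_left ?_ (by linarith))
    calc (m : ℝ) ^ δ ≤ ((q : ℝ) ^ 3) ^ δ :=
          Real.rpow_le_rpow (by positivity) (by exact_mod_cast hmq) hδ0.le
      _ = ((q : ℝ) ^ δ) ^ 3 := by
          rw [← Real.rpow_natCast, ← Real.rpow_natCast, ← Real.rpow_mul hqr.le,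
            ← Real.rpow_mul hqr.le, mul_comm]
  obtain ⟨γ, hγ, hle⟩ := exists_smul_eq_of_relation hn hq x y hr hrx' hR hRq hW
  refine ⟨γ, hγ, hle.trans (le_trans ?_ hqC)⟩
  set W := C * ((q : ℝ) ^ δ) ^ 3 with hWdef
  have hWq := hW q hq0 (Nat.le_self_pow (by norm_num) q)
  have hW0 : 0 ≤ W := le_trans (by positivity) hWq
  calc 12 * (n : ℝ) ^ 6 * W ^ 5 * R * q
      ≤ 12 * (n : ℝ) ^ 6 * W ^ 5 * (2 * W * (q : ℝ) ^ s) * q := by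
        gcongr
        exact hRs.trans (by gcongr)
    _ = 24 * n ^ 6 * C ^ 6 * (((q : ℝ) ^ δ) ^ 18 * (q : ℝ) ^ s * (q : ℝ) ^ (1 : ℝ)) := by
        rw [hWdef, Real.rpow_one]
        ring
    _ = _ := by
        rw [← Real.rpow_mul_natCast hqr.le, ← Real.rpow_add hqr, ← Real.rpow_add hqr]
        congr 2
        push_cast
        ring

theorem lt_floor_rpow_inv_add_one_pow {q m : ℕ} (hm : m ≠ 0) :
    q < (⌊(q : ℝ) ^ (1 / (m : ℝ))⌋₊ + 1) ^ m := by
  have h := Nat.lt_floor_add_one ((q : ℝ) ^ (1 / (m : ℝ)))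
  have h1 : ((q : ℝ) ^ (1 / (m : ℝ))) ^ m = q := by
    rw [one_div, Real.rpow_inv_natCast_pow (by positivity) hm]
  have h2 := pow_lt_pow_left₀ h (by positivity) hm
  rw [h1] at h2
  exact_mod_cast h2

theorem liminfAffine_le {n : ℕ} (hn : 2 ≤ n) :
    liminfAffine n ≤ ((1 + 1 / (n : ℝ) : ℝ) : EReal) := by
  refine EReal.le_of_forall_lt_iff_le.1 fun z hz => ?_
  have hz := EReal.coe_lt_coe_iff.1 hz
  have hev := eventually_diamExp_primVec_le hn (s := 1 / (n : ℝ)) (by positivity) hz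
  refine Filter.liminf_le_of_frequently_le' ?_
  -- A liminf is bounded above by its values along the primes.
  have hprime : ∃ᶠ q : ℕ in Filter.atTop, q.Prime :=
    Nat.frequently_atTop_iff_infinite.2 Nat.infinite_setOfPred_prime
  refine (hprime.and_eventually hev).mono fun q hq => hq.2 fun a => ?_
  have hq2 : (1 : ℝ) < q := by exact_mod_cast hq.1.one_lt
  have hfl := Nat.floor_le (a := (q : ℝ) ^ (1 / (n : ℝ))) (by positivity)
  have hKq : ⌊(q : ℝ) ^ (1 / (n : ℝ))⌋₊ < q := by
    have h1 : (1 : ℝ) < n := by exact_mod_cast hn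
    have h2 : (q : ℝ) ^ (1 / (n : ℝ)) < (q : ℝ) ^ (1 : ℝ) :=
      Real.rpow_lt_rpow_of_exponent_lt hq2 (by rw [div_lt_one (by linarith)]; exact h1)
    rw [Real.rpow_one] at h2
    exact_mod_cast hfl.trans_lt h2
  obtain ⟨r, hr, hrK, hra⟩ := exists_short_primitive_relation_of_prime hq.1 a
    (lt_floor_rpow_inv_add_one_pow (by omega)) hKq
  refine ⟨r, _, hr, hra, hrK, hKq.le.trans (Nat.le_self_pow (by norm_num) q), hfl.trans ?_⟩
  refine le_mul_of_one_le_left (by positivity) ?_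
  have : (1 : ℝ) ≤ 2 ^ q.primeFactors.card := one_le_pow₀ (by norm_num)
  linarith

theorem limsupAffine_le {n : ℕ} (hn : 2 ≤ n) :
    limsupAffine n ≤ ((1 + 1 / ((n : ℝ) - 1) : ℝ) : EReal) := by
  have hn1 : ((n - 1 : ℕ) : ℝ) = (n : ℝ) - 1 := by
    rw [Nat.cast_sub (by omega), Nat.cast_one]
  rw [← hn1]
  refine EReal.le_of_forall_lt_iff_le.1 fun z hz => ?_
  have hz := EReal.coe_lt_coe_iff.1 hz
  have hev := eventually_diamExp_primVec_le hn (s := 1 / ((n - 1 : ℕ) : ℝ)) (by positivity) hz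
  refine Filter.limsup_le_of_le (by isBoundedDefault) ?_
  filter_upwards [hev, Filter.eventually_ge_atTop 2] with q hq hq2
  refine hq fun a => ?_
  have hqr : (1 : ℝ) ≤ q := by exact_mod_cast (by omega : 1 ≤ q)
  have hfl := Nat.floor_le (a := (q : ℝ) ^ (1 / ((n - 1 : ℕ) : ℝ))) (by positivity)
  have hKq : ⌊(q : ℝ) ^ (1 / ((n - 1 : ℕ) : ℝ))⌋₊ ≤ q := by
    have h1 : (1 : ℝ) ≤ (n - 1 : ℕ) := by exact_mod_cast (by omega : 1 ≤ n - 1)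
    have h2 : (q : ℝ) ^ (1 / ((n - 1 : ℕ) : ℝ)) ≤ (q : ℝ) ^ (1 : ℝ) :=
      Real.rpow_le_rpow_of_exponent_le hqr (by rw [div_le_one (by linarith)]; exact h1)
    rw [Real.rpow_one] at h2
    exact_mod_cast hfl.trans h2
  obtain ⟨r, hr, hrK, hra⟩ := exists_short_primitive_relation hn (by omega : q ≠ 0) a
    (lt_floor_rpow_inv_add_one_pow (by omega))
  set K := ⌊(q : ℝ) ^ (1 / ((n - 1 : ℕ) : ℝ))⌋₊
  refine ⟨r, (2 ^ q.primeFactors.card + 1) * K, hr, hra, by exact_mod_cast hrK, ?_, ?_⟩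
  · have h1 := two_pow_card_primeFactors_le (by omega : q ≠ 0)
    calc (2 ^ q.primeFactors.card + 1) * K ≤ (q + 1) * q := by gcongr
      _ ≤ (q * q) * q := Nat.mul_le_mul_right _ (by nlinarith)
      _ = q ^ 3 := by ring
  · push_cast
    have : (1 : ℝ) ≤ 2 ^ q.primeFactors.card := one_le_pow₀ (by norm_num)
    gcongr
    linarith

/-! ### Lower bounds -/

theorem primVec_of_isUnit {n q : ℕ} {x : Fin n → ZMod q} {i : Fin n} (h : IsUnit (x i)) :
    Nat.gcd q (Finset.univ.gcd fun i => (x i).val) = 1 := by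
  obtain ⟨u, hu⟩ := h
  refine (primVec_iff x).2 ⟨Pi.single i ((u⁻¹ : (ZMod q)ˣ) : ZMod q), ?_⟩
  rw [single_dotProduct, ← hu, Units.inv_mul]

/-- The `i`-th standard basis vector. -/
def PrimVec.single {n : ℕ} (q : ℕ) (i : Fin n) : PrimVec n q :=
  ⟨Pi.single i 1, primVec_of_isUnit (i := i) (by rw [Pi.single_eq_same]; exact isUnit_one)⟩

theorem smul_single_apply {n q : ℕ} (γ : SL(n, ℤ)) (i l : Fin n) :
    (γ • PrimVec.single q i).1 l = (γ.1 l i : ZMod q) := by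
  rw [PrimVec.smul_apply]
  simp [PrimVec.single, Pi.single_apply]

/-- The vector with coordinate `1` at `i` and coordinates `f l` elsewhere. -/
def PrimVec.affine {n q : ℕ} (i : Fin n) (f : Fin n → ZMod q) : PrimVec n q :=
  ⟨Function.update f i 1,
    primVec_of_isUnit (i := i) (by rw [Function.update_self]; exact isUnit_one)⟩

theorem PrimVec.affine_self {n q : ℕ} (i : Fin n) (f : Fin n → ZMod q) :
    (PrimVec.affine i f).1 i = 1 := Function.update_self ..

theorem PrimVec.affine_of_ne {n q : ℕ} {i l : Fin n} (h : l ≠ i) (f : Fin n → ZMod q) :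
    (PrimVec.affine i f).1 l = f l := Function.update_of_ne h ..

/-- The class of a primitive vector in projective space. -/
def ProjSpace.mk {n q : ℕ} (x : PrimVec n q) : ProjSpace n q :=
  Quotient.mk _ x

/-- The other integers in the class of `⌊q/2⌋` are at distance at least `q - ⌊q/2⌋ ≥ ⌊q/2⌋` from
`0`. -/
theorem half_le_abs_of_cast_eq {q : ℕ} (t : ℤ) (h : (t : ZMod q) = ((q / 2 : ℕ) : ZMod q)) :
    ((q / 2 : ℕ) : ℝ) ≤ |(t : ℝ)| := by
  suffices h' : ((q / 2 : ℕ) : ℤ) ≤ |t| by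
    have := (Int.cast_le (R := ℝ)).2 h'
    rwa [Int.cast_natCast, Int.cast_abs] at this
  have h1 : (t : ZMod q) = (((q / 2 : ℕ) : ℤ) : ZMod q) := by rw [h, Int.cast_natCast]
  obtain ⟨k, hk⟩ := (ZMod.intCast_eq_intCast_iff_dvd_sub _ _ _).1 h1
  have h2 : 2 * ((q / 2 : ℕ) : ℤ) ≤ q := by omega
  rcases lt_trichotomy k 0 with h0 | h0 | h0
  · have : (q : ℤ) * k ≤ q * (-1) := mul_le_mul_of_nonneg_left (by omega) (by positivity)
    have := le_abs_self t
    omega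
  · rw [h0, mul_zero] at hk
    have := le_abs_self t
    omega
  · have : (q : ℤ) * 1 ≤ q * k := mul_le_mul_of_nonneg_left (by omega) (by positivity)
    have := neg_le_abs t
    omega

theorem rpow_le_half_of_const_mul_rpow_le {q : ℕ} {c : ℝ} (hq : 2 ≤ q)
    (h : 4 * (q : ℝ) ^ c ≤ (q : ℝ) ^ (1 : ℝ)) : (q : ℝ) ^ c ≤ ((q / 2 : ℕ) : ℝ) := by
  rw [Real.rpow_one] at h
  have h1 : (q : ℝ) ≤ 4 * ((q / 2 : ℕ) : ℝ) := by exact_mod_cast (by omega : q ≤ 4 * (q / 2))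
  linarith

theorem one_le_liminfAffine {n : ℕ} (hn : 2 ≤ n) : (1 : EReal) ≤ liminfAffine n := by
  rw [← EReal.coe_one]
  refine EReal.ge_of_forall_gt_iff_ge.1 fun z hz => ?_
  have hz := EReal.coe_lt_coe_iff.1 hz
  refine Filter.le_liminf_of_le (by isBoundedDefault) ?_
  filter_upwards [eventually_const_mul_rpow_le 4 hz, Filter.eventually_ge_atTop 2] with q hqz hq
  let i : Fin n := ⟨0, by omega⟩
  let j : Fin n := ⟨1, by omega⟩
  have hji : j ≠ i := by simp [i, j]
  refine le_diamExp hq (PrimVec.single q i)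
    (PrimVec.affine i fun _ => ((q / 2 : ℕ) : ZMod q)) fun γ hγ => ?_
  refine le_trans (rpow_le_half_of_const_mul_rpow_le hq hqz)
    (le_trans ?_ (abs_entry_le_slNorm γ j i))
  have h1 := half_le_abs_of_cast_eq (γ.1 j i) (by
    rw [← smul_single_apply, hγ]
    exact PrimVec.affine_of_ne hji _)
  exact h1

theorem ProjSpace.exists_units_of_smul_eq {n q : ℕ} {γ : SL(n, ℤ)} {x y : PrimVec n q}
    (h : γ • ProjSpace.mk x = ProjSpace.mk y) :
    ∃ u : (ZMod q)ˣ, γ • x = u • y := by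
  obtain ⟨u, hu⟩ := Quotient.exact h
  exact ⟨u, hu.symm⟩

/-- Units modulo `2 * m` are odd. Hence for even `q` the coordinate `q/2` survives rescaling, and
even `q` suffice for a limsup. -/
theorem units_mul_half {m : ℕ} (u : (ZMod (2 * m))ˣ) : (u : ZMod (2 * m)) * m = m := by
  rcases Nat.eq_zero_or_pos m with rfl | hm
  · simp
  have : NeZero (2 * m) := ⟨by omega⟩
  have hcop := ZMod.val_coe_unit_coprime u
  have hodd : ¬ 2 ∣ (u : ZMod (2 * m)).val := by
    intro h
    have := Nat.dvd_gcd h (dvd_mul_right 2 m)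
    rw [hcop.gcd_eq_one] at this
    omega
  obtain ⟨k, hk⟩ : ∃ k, (u : ZMod (2 * m)).val = 2 * k + 1 :=
    ⟨(u : ZMod (2 * m)).val / 2, by omega⟩
  have h2m : (2 : ZMod (2 * m)) * m = 0 := by
    have := ZMod.natCast_self (2 * m)
    push_cast at this
    exact this
  rw [← ZMod.natCast_zmod_val (u : ZMod (2 * m)), hk]
  push_cast
  linear_combination (k : ZMod (2 * m)) * h2m

theorem one_le_limsupProj {n : ℕ} (hn : 2 ≤ n) : (1 : EReal) ≤ limsupProj n := by
  rw [← EReal.coe_one]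
  refine EReal.ge_of_forall_gt_iff_ge.1 fun z hz => ?_
  have hz := EReal.coe_lt_coe_iff.1 hz
  refine Filter.le_limsup_of_frequently_le' ?_
  have heven : ∃ᶠ q : ℕ in Filter.atTop, Even q :=
    Filter.frequently_atTop.2 fun a => ⟨2 * a, by omega, even_two_mul a⟩
  refine (heven.and_eventually ((eventually_const_mul_rpow_le 4 hz).and
    (Filter.eventually_ge_atTop 2))).mono ?_
  rintro q ⟨heq, hqz, hq⟩
  let i : Fin n := ⟨0, by omega⟩
  let j : Fin n := ⟨1, by omega⟩
  have hji : j ≠ i := by simp [i, j]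
  refine le_diamExp hq (ProjSpace.mk (PrimVec.single q i))
    (ProjSpace.mk (PrimVec.affine i fun _ => ((q / 2 : ℕ) : ZMod q))) fun γ hγ => ?_
  obtain ⟨u, hu⟩ := ProjSpace.exists_units_of_smul_eq hγ
  refine le_trans (rpow_le_half_of_const_mul_rpow_le hq hqz)
    (le_trans ?_ (abs_entry_le_slNorm γ j i))
  have h1 := half_le_abs_of_cast_eq (γ.1 j i) (by
    rw [← smul_single_apply, hu]
    change (u : ZMod q) * (PrimVec.affine i _).1 j = _
    rw [PrimVec.affine_of_ne hji]
    obtain ⟨m, rfl⟩ := heq.two_dvd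
    rw [Nat.mul_div_cancel_left m two_pos]
    exact units_mul_half u)
  exact h1

/-- Counting first columns: some point of projective space is far from a basis vector. -/
theorem exists_forall_lt_slNorm {n q : ℕ} (hq : q ≠ 0) (i : Fin n) {B : ℕ}
    (hB : (2 * B + 1) ^ n < q ^ (n - 1)) :
    ∃ y : ProjSpace n q, ∀ γ : SL(n, ℤ),
      γ • ProjSpace.mk (PrimVec.single q i) = y → (B : ℝ) < slNorm γ := by
  classical
  by_contra! hcon
  have : NeZero q := ⟨hq⟩
  let J := (Finset.univ : Finset (Fin n)).erase i
  let ext : (J → ZMod q) → Fin n → ZMod q := fun f l => if h : l ∈ J then f ⟨l, h⟩ else 0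
  choose γ hγ hγB using fun f : J → ZMod q =>
    hcon (ProjSpace.mk (PrimVec.affine i (ext f)))
  have hmem : ∀ f l, (γ f).1 l i ∈ Finset.Icc (-(B : ℤ)) B := by
    intro f l
    rw [Finset.mem_Icc, ← abs_le]
    exact_mod_cast (abs_entry_le_slNorm (γ f) l i).trans (hγB f)
  -- Column `i` of `γ f` recovers `f`: coordinate `i` of the affine point is `1`, so it gives the
  -- unit scalar, and the other coordinates then give `f`.
  have hinj : Function.Injective fun f l =>
      (⟨(γ f).1 l i, hmem f l⟩ : Finset.Icc (-(B : ℤ)) B) := by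
    intro f g hfg
    have hcol : ∀ l, (γ f).1 l i = (γ g).1 l i := fun l => congrArg Subtype.val (congrFun hfg l)
    obtain ⟨u, hu⟩ := ProjSpace.exists_units_of_smul_eq (hγ f)
    obtain ⟨w, hw⟩ := ProjSpace.exists_units_of_smul_eq (hγ g)
    have hl : ∀ l, (u : ZMod q) * (PrimVec.affine i (ext f)).1 l
        = w * (PrimVec.affine i (ext g)).1 l := by
      intro l
      have h1 := congrArg (fun x : PrimVec n q => x.1 l) hu
      have h2 := congrArg (fun x : PrimVec n q => x.1 l) hw
      simp only [smul_single_apply] at h1 h2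
      rw [hcol l, h2] at h1
      exact h1.symm
    have huw : u = w := by
      have := hl i
      rw [PrimVec.affine_self, PrimVec.affine_self, mul_one, mul_one] at this
      exact Units.ext this
    subst huw
    funext l
    have h1 := (Units.mul_right_inj u).1 (hl l)
    have hli : (l : Fin n) ≠ i := Finset.ne_of_mem_erase l.2
    rw [PrimVec.affine_of_ne hli, PrimVec.affine_of_ne hli] at h1
    simpa only [ext, l.2, dif_pos] using h1
  have hcard := Fintype.card_le_of_injective _ hinj
  simp only [Fintype.card_fun, Fintype.card_coe, Int.card_Icc, ZMod.card, Fintype.card_fin] at hcard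
  rw [Finset.card_erase_of_mem (Finset.mem_univ i), Finset.card_univ, Fintype.card_fin] at hcard
  have : ((B : ℤ) + 1 - -(B : ℤ)).toNat = 2 * B + 1 := by omega
  rw [this] at hcard
  omega

theorem le_liminfProj {n : ℕ} (hn : 2 ≤ n) :
    ((((n : ℝ) - 1) / (n : ℝ) : ℝ) : EReal) ≤ liminfProj n := by
  refine EReal.ge_of_forall_gt_iff_ge.1 fun z hz => ?_
  have hz := EReal.coe_lt_coe_iff.1 hz
  have hn1 : (1 : ℝ) < n := by exact_mod_cast hn
  have hn0 : (0 : ℝ) < n := by linarith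
  -- A nonnegative exponent gives `q ^ c ≥ 1`, hence `2 * ⌈q ^ c⌉ + 1 ≤ 5 * q ^ c`; the extra `2` in
  -- `2 * 5 ^ n` below makes the count strict.
  set c := max z 0 with hcdef
  have hc0 : 0 ≤ c := le_max_right _ _
  have hc : n * c < ((n - 1 : ℕ) : ℝ) := by
    have : c < ((n : ℝ) - 1) / n := max_lt hz (div_pos (by linarith) hn0)
    rw [lt_div_iff₀ hn0] at this
    rw [Nat.cast_sub (by omega), Nat.cast_one]
    linarith
  refine Filter.le_liminf_of_le (by isBoundedDefault) ?_
  filter_upwards [eventually_const_mul_rpow_le (2 * 5 ^ n) hc, Filter.eventually_ge_atTop 2]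
    with q hqz hq
  have hq1 : (1 : ℝ) ≤ q := by exact_mod_cast (by omega : 1 ≤ q)
  have hqc1 : (1 : ℝ) ≤ (q : ℝ) ^ c := Real.one_le_rpow hq1 hc0
  let i : Fin n := ⟨0, by omega⟩
  have hB : (2 * ⌈(q : ℝ) ^ c⌉₊ + 1) ^ n < q ^ (n - 1) := by
    have h1 : ((2 * ⌈(q : ℝ) ^ c⌉₊ + 1 : ℕ) : ℝ) ≤ 5 * (q : ℝ) ^ c := by
      have := Nat.ceil_lt_add_one (a := (q : ℝ) ^ c) (by positivity)
      push_cast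
      linarith
    have h2 : ((2 * ⌈(q : ℝ) ^ c⌉₊ + 1 : ℕ) : ℝ) ^ n ≤ 5 ^ n * (q : ℝ) ^ (n * c) := by
      refine (pow_le_pow_left₀ (by positivity) h1 n).trans_eq ?_
      rw [mul_pow, ← Real.rpow_mul_natCast (by positivity), mul_comm c]
    have h3 : 0 < 5 ^ n * (q : ℝ) ^ (n * c) := by positivity
    rw [Real.rpow_natCast] at hqz
    have h4 : ((2 * ⌈(q : ℝ) ^ c⌉₊ + 1 : ℕ) : ℝ) ^ n < (q : ℝ) ^ (n - 1) := by linarith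
    exact_mod_cast h4
  obtain ⟨y, hy⟩ := exists_forall_lt_slNorm (by omega : q ≠ 0) i hB
  refine le_diamExp hq (ProjSpace.mk (PrimVec.single q i)) y fun γ hγ => ?_
  calc (q : ℝ) ^ z ≤ (q : ℝ) ^ c := Real.rpow_le_rpow_of_exponent_le hq1 (le_max_left _ _)
    _ ≤ ⌈(q : ℝ) ^ c⌉₊ := Nat.le_ceil _
    _ ≤ slNorm γ := (hy γ hγ).le

theorem proposition5p3 (n : ℕ) (hn : 2 ≤ n) :
    ((1 : EReal) ≤ liminfAffine n ∧ liminfAffine n ≤ ((1 + 1 / (n : ℝ) : ℝ) : EReal)) ∧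
    ((1 : EReal) ≤ limsupAffine n ∧ limsupAffine n ≤ ((1 + 1 / ((n : ℝ) - 1) : ℝ) : EReal)) ∧
    ((((n : ℝ) - 1) / (n : ℝ) : ℝ) : EReal) ≤ liminfProj n ∧
    liminfProj n ≤ limsupProj n ∧
    limsupProj n = 1 := by
  refine ⟨⟨one_le_liminfAffine hn, liminfAffine_le hn⟩,
    ⟨(one_le_liminfAffine hn).trans Filter.liminf_le_limsup, limsupAffine_le hn⟩,
    le_liminfProj hn, Filter.liminf_le_limsup, le_antisymm ?_ (one_le_limsupProj hn)⟩
  rw [← EReal.coe_one]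
  refine EReal.le_of_forall_lt_iff_le.1 fun z hz => ?_
  exact Filter.limsup_le_of_le (by isBoundedDefault)
    (eventually_diamExp_projSpace_le (by omega) (EReal.coe_lt_coe_iff.1 hz))
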